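/- **Setting.** Let $\mathcal X,\mathcal W$ be Polish spaces with their Borel $\sigma$-algebras. A *stationary noise process* is a quadruple $(\mathcal W,(\mathscr P_t)_{t\ge 0},\mathbf P_\omega,(\theta_t)_{t\ge 0})$ where $(\mathscr P_t)$ is a semigroup of Markov kernels on $\mathcal W$ ($\mathscr P_0=\mathrm{id}$, $\mathscr P_{s+t}=\mathscr P_s\mathscr P_t$) mapping bounded continuous functions to continuous functions, $\mathbf P_\omega$ is its unique invariant probability measure, and $(\theta_t)$ is a semiflow of measurable maps of $\mathcal W$ ($\theta_0=\mathrm{id}$, $\theta_{s+t}=\theta_s\circ\theta_t$) with $\theta_t^*\mathscr P_t(w,\cdot)=\delta_w$ for all $t>0$, $w\in\mathcal W$ (here $f^*m$ is the image of the measure $m$ under $f$). A *continuous stochastic dynamical system (SDS)* over it is a map $\Lambda:\mathbb R_+\times\mathcal X\times\mathcal W\to\mathcal X$ such that, with $\Phi_T(x,w)(t):=\Lambda_t(x,\theta_{T-t}w)$ for $t\in[0,T]$: (i) $\Phi_T(x,w)\in C([0,T];\mathcal X)$ for all $T,x,w$; (ii) for every $T$, the map $(x,w)\mapsto\Phi_T(x,w)$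 from $\mathcal X\times\mathcal W$ to $C([0,T];\mathcal X)$ is continuous at every point of $\mathcal X\times\operatorname{supp}\mathbf P_\omega$; (iii) $\Lambda_0(x,w)=x$ and $\Lambda_{s+t}(x,w)=\Lambda_s(\Lambda_t(x,\theta_sw),w)$. Let $\mathcal Q_t(x,w;\cdot)$ be the law on $\mathcal X\times\mathcal W$ of $(\Lambda_t(x,w'),w')$ with $w'\sim\mathscr P_t(w,\cdot)$. Let $\mathcal M_\Lambda$ be the set of probability measures on $\mathcal X\times\mathcal W$ with $\mathcal W$-marginal $\mathbf P_\omega$ (generalised initial conditions). For a probability measure $\mu$ on $\mathcal X\times\mathcal W$ whose $\mathcal W$-marginal is carried by $\operatorname{supp}\mathbf P_\omega$, let $\bar{\mathcal Q}\mu$ be the law on $C(\mathbb R_+;\mathcal X)$ of the $\mathcal X$-component of the Markov process with transition probabilities $\mathcal Q_t$ and initial law $\mu$ (this law exists and is unique). A measure $\mu\in\mathcal M_\Lambda$ is *invariant* for $\Lambda$ if $\mathcal Q_t\mu=\mu$ for all $t\ge0$. Two measures $\mu,\nu\in\mathcal M_\Lambda$ are *equivalent* if $\bar{\mathcal Q}\mu=\bar{\mathcal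 Q}\nu$. Let $R_t$ denote restriction of paths to $[t,\infty)$. * $\Lambda$ is *strong Feller at time $t$* if there is $\ell:\mathcal X^2\times\mathcal W\to\mathbb R_+$, continuous at every point of $\mathcal X^2\times\operatorname{supp}\mathbf P_\omega$, such that for every $x$, $\ell(x,x,w)=0$ for $\mathbf P_\omega$-a.e. $w$, and, for all $x,y\in\mathcal X$, $\|R_t^*\bar{\mathcal Q}\delta_{(x,w)}-R_t^*\bar{\mathcal Q}\delta_{(y,w)}\|_{TV}\le\ell(x,y,w)$ for $\mathbf P_\omega$-a.e. $w$. * $\Lambda$ is *topologically irreducible at time $s$* if, for $\mathbf P_\omega$-a.e. $w$ (with an exceptional null set that does not depend on $x$ and $U$), $\mathcal Q_s(x,w;U\times\mathcal W)>0$ for every $x\in\mathcal X$ and every non-empty open $U\subset\mathcal X$. * Put $\mathcal N^t_{\mathcal W}=\{(w,\tilde w)\in\mathcal W^2: R_t^*\bar{\mathcal Q}\delta_{(x,w)}\sim R_t^*\bar{\mathcal Q}\delta_{(x,\tilde w)}\ \text{for all }x\in\mathcal X\}$, where $\sim$ is mutual absolute continuity. $\Lambda$ is *quasi-Markovian* if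 for all open $V,U\subset\mathcal W$ and all $s,t>0$ there is a measurable map $\operatorname{supp}\mathbf P_\omega\ni w\mapsto\mathscr P_s^{V,U}(w,\cdot)$ into the positive finite measures on $\mathcal W^2$ such that for every $w\in\operatorname{supp}\mathbf P_\omega$: the two marginals of $\mathscr P_s^{V,U}(w,\cdot)$ are bounded above by the restrictions $\mathscr P_s(w,\cdot)|_V$ and $\mathscr P_s(w,\cdot)|_U$ respectively; and if $\min\{\mathscr P_s(w,V),\mathscr P_s(w,U)\}>0$ then $\mathscr P_s^{V,U}(w,\mathcal N^t_{\mathcal W})>0$. (Objects at noises outside $\operatorname{supp}\mathbf P_\omega$ play no role; a measure of a set that may fail to be Borel is taken with respect to the associated outer measure.) **Theorem.** Let $\Lambda$ be a quasi-Markovian SDS. If there exist times $s>0$ and $t>0$ such that $\Lambda$ is strong Feller at time $t$ and topologically irreducible at time $s$, then $\Lambda$ has at most one invariant measure up to equivalence: any two invariant measures $\mu,\nu\in\mathcal M_\Lambda$ satisfy $\bar{\mathcal Q}\mu=\bar{\mathcal Q}\nu$. -/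

import Mathlib

open MeasureTheory ProbabilityTheory Topology
open scoped NNReal ENNReal BoundedContinuousFunction

set_option linter.unusedSectionVars false

/-- The space `C(ι, X)` of continuous paths carries the `σ`-algebra generated by the evaluations,
which is its Borel `σ`-algebra, see `pathBorelSpace`. -/
instance pathMeasurableSpace {ι X : Type*} [TopologicalSpace ι] [TopologicalSpace X]
    [MeasurableSpace X] : MeasurableSpace C(ι, X) :=
  MeasurableSpace.comap (fun f i => f i) MeasurableSpace.pi

/-- The `σ`-algebra generated by the evaluations is the Borel `σ`-algebra of the topology of
locally uniform convergence. -/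
instance pathBorelSpace {ι X : Type*} [TopologicalSpace ι] [TopologicalSpace.MetrizableSpace ι]
    [LocallyCompactSpace ι] [SecondCountableTopology ι] [TopologicalSpace X] [PolishSpace X]
    [MeasurableSpace X] [BorelSpace X] : BorelSpace C(ι, X) := by
  constructor
  apply le_antisymm
  · refine Measurable.comap_le (@measurable_pi_iff _ _ _ (borel C(ι, X)) _ _ |>.2 fun i => ?_)
    have : @BorelSpace C(ι, X) _ (borel _) := @BorelSpace.mk _ _ (borel _) rfl
    exact @Continuous.measurable _ _ _ (borel _) _ _ _ _ _ (continuous_eval_const i)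
  · rw [borel_eq_generateFrom_of_subbasis (ContinuousMap.compactOpen_eq)]
    refine MeasurableSpace.generateFrom_le ?_
    rintro _ ⟨K, hK, U, hU, rfl⟩
    let := TopologicalSpace.metrizableSpaceMetric X
    obtain ⟨D, hDK, hDc, hKD⟩ :=
      (TopologicalSpace.IsSeparable.of_separableSpace K).exists_countable_dense_subset
    have hUo : IsOpen U := hU
    have hUc : IsClosed Uᶜ := hUo.isClosed_compl
    let F : ℕ → Set X := fun n => {x | ((n : ℝ≥0∞))⁻¹ ≤ Metric.infEDist x Uᶜ}
    have hF : ∀ n, IsClosed (F n) := fun n => isClosed_le continuous_const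
      Metric.continuous_infEDist
    have h : {f : C(ι, X) | Set.MapsTo f K U} = ⋃ n, ⋂ d ∈ D, {f : C(ι, X) | f d ∈ F n} := by
      ext f
      simp only [Set.mem_ofPred_eq, Set.mem_iUnion, Set.mem_iInter]
      constructor
      · intro hf
        rcases K.eq_empty_or_nonempty with rfl | hne
        · exact ⟨0, fun d hd => absurd (hDK hd) (by simp)⟩
        obtain ⟨k, hk, hmin⟩ := hK.exists_isMinOn hne
          (Metric.continuous_infEDist (s := Uᶜ).comp f.continuous).continuousOn
        have hpos : Metric.infEDist (f k) Uᶜ ≠ 0 := fun h0 =>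
          ((Metric.mem_iff_infEDist_zero_of_closed hUc).2 h0) (hf hk)
        obtain ⟨n, hn⟩ := ENNReal.exists_inv_nat_lt hpos
        exact ⟨n, fun d hd => hn.le.trans (hmin (hDK hd))⟩
      · rintro ⟨n, hn⟩ k hk
        have h1 : k ∈ closure D := hKD hk
        have h2 : closure D ⊆ f ⁻¹' F n := closure_minimal hn ((hF n).preimage f.continuous)
        have h3 : (n : ℝ≥0∞)⁻¹ ≤ Metric.infEDist (f k) Uᶜ := h2 h1
        by_contra hkU
        rw [Metric.infEDist_zero_of_mem hkU] at h3
        simp at h3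
    change MeasurableSet {f : C(ι, X) | Set.MapsTo f K U}
    rw [h]
    refine MeasurableSet.iUnion fun n => MeasurableSet.biInter hDc fun d _ => ?_
    have : Measurable fun f : C(ι, X) => f d := (measurable_pi_apply d).comp (comap_measurable _)
    exact this (hF n).measurableSet

/-- A stationary noise process `(W, (P_t), law, (θ_t))` on a Polish space `W`. -/
structure StationaryNoise (W : Type*) [TopologicalSpace W] [PolishSpace W] [MeasurableSpace W]
    [BorelSpace W] where
  /-- the transition semigroup -/
  P : ℝ≥0 → Kernel W W
  isMarkovKernel : ∀ t, IsMarkovKernel (P t)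
  P_zero : P 0 = Kernel.id
  P_add : ∀ s t, P (s + t) = P t ∘ₖ P s
  feller : ∀ (t : ℝ≥0) (f : W →ᵇ ℝ), Continuous fun w => ∫ w', f w' ∂(P t w)
  /-- the unique invariant probability measure of the semigroup -/
  law : Measure W
  isProbabilityMeasure : IsProbabilityMeasure law
  invariant : ∀ t, (P t).Invariant law
  unique : ∀ ν : Measure W, IsProbabilityMeasure ν → (∀ t, (P t).Invariant ν) → ν = law
  /-- the semiflow recovering the past of the noise -/
  θ : ℝ≥0 → W → W
  measurable_θ : ∀ t, Measurable (θ t)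
  θ_zero : ∀ w, θ 0 w = w
  θ_add : ∀ s t w, θ (s + t) w = θ s (θ t w)
  map_θ : ∀ t, 0 < t → ∀ w, (P t w).map (θ t) = Measure.dirac w

instance {W : Type*} [TopologicalSpace W] [PolishSpace W] [MeasurableSpace W] [BorelSpace W]
    (N : StationaryNoise W) (t : ℝ≥0) : IsMarkovKernel (N.P t) := N.isMarkovKernel t

instance {W : Type*} [TopologicalSpace W] [PolishSpace W] [MeasurableSpace W] [BorelSpace W]
    (N : StationaryNoise W) : IsProbabilityMeasure N.law := N.isProbabilityMeasure

/-- A continuous stochastic dynamical system on `X` over the noise `N`, where continuity with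
respect to the noise is only required at the points of the support of the law of the noise. -/
structure SDS (X : Type*) {W : Type*} [TopologicalSpace X] [PolishSpace X] [MeasurableSpace X]
    [BorelSpace X] [TopologicalSpace W] [PolishSpace W] [MeasurableSpace W] [BorelSpace W]
    (N : StationaryNoise W) where
  /-- the map `Λ_t(x, w)` -/
  Λ : ℝ≥0 → X → W → X
  continuous_path : ∀ (T : ℝ≥0) (x : X) (w : W),
    Continuous fun t : Set.Icc 0 T => Λ t x (N.θ (T - t) w)
  continuousAt_path : ∀ (T : ℝ≥0) (x : X), ∀ w ∈ N.law.support,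
    ContinuousAt (fun p : X × W =>
      (⟨fun t => Λ t p.1 (N.θ (T - t) p.2), continuous_path T p.1 p.2⟩ : C(Set.Icc 0 T, X)))
      (x, w)
  Λ_zero : ∀ x w, Λ 0 x w = x
  cocycle : ∀ s t x w, Λ (s + t) x w = Λ s (Λ t x (N.θ s w)) w

/-- A positive measure `π` on `E × E` is a subcoupling of `m₁` and `m₂` if its two marginals are
dominated by `m₁` and `m₂`. -/
def IsSubcoupling {E : Type*} [MeasurableSpace E] (π : Measure (E × E)) (m₁ m₂ : Measure E) :
    Prop :=
  π.map Prod.fst ≤ m₁ ∧ π.map Prod.snd ≤ m₂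

/-- The total variation norm `‖m₁ - m₂‖_TV`. -/
noncomputable def tvNorm {E : Type*} [MeasurableSpace E] (m₁ m₂ : Measure E) [IsFiniteMeasure m₁]
    [IsFiniteMeasure m₂] : ℝ≥0∞ :=
  (m₁.toSignedMeasure - m₂.toSignedMeasure).totalVariation Set.univ

namespace SDS

variable {X W : Type*} [TopologicalSpace X] [PolishSpace X] [MeasurableSpace X] [BorelSpace X]
  [TopologicalSpace W] [PolishSpace W] [MeasurableSpace W] [BorelSpace W] {N : StationaryNoise W}

/-- The transition probabilities `Q_t(x, w; ·)` on `X × W`: the law of `(Λ_t(x, w'), w')` for `w'`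
distributed according to `P_t(w, ·)`.  For `w` in the support of the law of the noise the map
`w' ↦ Λ_t(x, w')` is automatically `P_t(w, ·)`-almost everywhere measurable. -/
noncomputable def Q (S : SDS X N) (t : ℝ≥0) (z : X × W) : Measure (X × W) :=
  (N.P t z.2).map fun w' => (S.Λ t z.1 w', w')

/-- Generalised initial conditions: probability measures on `X × W` whose marginal on `W` is the
law of the noise. -/
def IsGeneralisedInitialCondition (_S : SDS X N) (μ : Measure (X × W)) : Prop :=
  IsProbabilityMeasure μ ∧ μ.map Prod.snd = N.law

/-- Invariant measures of the stochastic dynamical system. -/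
def IsInvariantMeasure (S : SDS X N) (μ : Measure (X × W)) : Prop :=
  S.IsGeneralisedInitialCondition μ ∧ ∀ t, μ.bind (S.Q t) = μ

/-- For `l = [(r₁, A₁), …, (rₙ, Aₙ)]`, the probability that the Markov process `(x_t, w_t)` with
transition probabilities `Q_t` started from `z` satisfies `x_{r₁ + ⋯ + rᵢ} ∈ Aᵢ` for all `i`. -/
noncomputable def finDimProb (S : SDS X N) : List (ℝ≥0 × Set X) → X × W → ℝ≥0∞
  | [], _ => 1
  | (r, A) :: l, z => ∫⁻ z', (Prod.fst ⁻¹' A).indicator (S.finDimProb l) z' ∂(S.Q r z)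

end SDS

/-- For `l = [(r₁, A₁), …, (rₙ, Aₙ)]`, the paths `f` with `f (t + r₁ + ⋯ + rᵢ) ∈ Aᵢ` for all
`i`. -/
def pathCylinder {X : Type*} [TopologicalSpace X] : ℝ≥0 → List (ℝ≥0 × Set X) → Set C(ℝ≥0, X)
  | _, [] => Set.univ
  | t, (r, A) :: l => {f | f (t + r) ∈ A} ∩ pathCylinder (t + r) l

namespace SDS

variable {X W : Type*} [TopologicalSpace X] [PolishSpace X] [MeasurableSpace X] [BorelSpace X]
  [TopologicalSpace W] [PolishSpace W] [MeasurableSpace W] [BorelSpace W] {N : StationaryNoise W}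

/-- `ρ` is the law on `C(ℝ₊, X)` of the `X`-component of the Markov process with transition
probabilities `Q_t` and initial law `μ`. -/
def IsPathLaw (S : SDS X N) (μ : Measure (X × W)) (ρ : Measure C(ℝ≥0, X)) : Prop :=
  IsProbabilityMeasure ρ ∧ ∀ l : List (ℝ≥0 × Set X), (∀ q ∈ l, MeasurableSet q.2) →
    ρ (pathCylinder 0 l) = ∫⁻ z, S.finDimProb l z ∂μ

theorem noise_compl_support (N : StationaryNoise W) (t : ℝ≥0) {w : W} (hw : w ∈ N.law.support) :
    N.P t w N.law.supportᶜ = 0 := by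
  let := TopologicalSpace.metrizableSpaceMetric W
  have hne : N.law.support.Nonempty := ⟨w, hw⟩
  let g : W → ℝ := fun w => min 1 (Metric.infDist w N.law.support)
  have hgc : Continuous g := continuous_const.min (Metric.continuous_infDist_pt _)
  have hg0 : ∀ w, 0 ≤ g w := fun w => le_min zero_le_one Metric.infDist_nonneg
  have hg1 : ∀ w, g w ≤ 1 := fun w => min_le_left _ _
  have hgS : ∀ w, g w = 0 ↔ w ∈ N.law.support := fun w => by
    rw [(Measure.isClosed_support).mem_iff_infDist_zero hne]
    have := Metric.infDist_nonneg (x := w) (s := N.law.support)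
    simp only [g]
    constructor
    · intro h
      rcases min_choice 1 (Metric.infDist w N.law.support) with h' | h'
      · rw [h'] at h; norm_num at h
      · rwa [h'] at h
    · intro h; rw [h]; norm_num
  let f : W →ᵇ ℝ := BoundedContinuousFunction.ofNormedAddCommGroup g hgc 1 fun w => by
    rw [Real.norm_eq_abs, abs_of_nonneg (hg0 w)]; exact hg1 w
  have hF := N.feller t f
  have hgm : Measurable g := hgc.measurable
  have hgi : ∀ ν : Measure W, IsFiniteMeasure ν → Integrable g ν := fun ν _ => f.integrable ν
  have h0 : ∀ᵐ w' ∂N.law, (∫ v, g v ∂(N.P t w')) = 0 := by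
    have h1 : ∀ᵐ w' ∂N.law, g w' = 0 := by
      filter_upwards [Measure.support_mem_ae (μ := N.law)] with v hv using (hgS v).2 hv
    have h2 : ∀ᵐ w' ∂((N.P t) ∘ₘ N.law), g w' = 0 := by
      have h3 : (N.P t) ∘ₘ N.law = N.law := N.invariant t
      rw [h3]; exact h1
    filter_upwards [Measure.ae_ae_of_ae_comp h2] with v hv
    exact integral_eq_zero_of_ae hv
  have h1 : (∫ v, g v ∂(N.P t w)) = 0 := by
    by_contra hne0
    have hopen : IsOpen {v | (∫ v', g v' ∂(N.P t v)) ≠ 0} :=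
      isOpen_ne_fun hF continuous_const
    have := (Measure.mem_support_iff_forall w).1 hw _ (hopen.mem_nhds hne0)
    exact this.ne' h0
  rw [integral_eq_zero_iff_of_nonneg hg0 (hgi _ inferInstance)] at h1
  filter_upwards [h1] with v hv using (hgS v).1 hv

theorem noise_ae_θ (N : StationaryNoise W) (t : ℝ≥0) (w : W) :
    ∀ᵐ w' ∂(N.P t w), N.θ t w' = w := by
  rcases eq_or_ne t 0 with rfl | ht
  · simp [N.P_zero, N.θ_zero, Kernel.id_apply, ae_dirac_eq]
  · have h : ∀ᵐ v ∂((N.P t w).map (N.θ t)), v = w := by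
      rw [N.map_θ t (pos_iff_ne_zero.2 ht) w]; simp [ae_dirac_eq]
    exact ae_of_ae_map (N.measurable_θ t).aemeasurable h

theorem measurableSet_support (N : StationaryNoise W) : MeasurableSet N.law.support :=
  Measure.isClosed_support.measurableSet

open Classical in
theorem measurable_piece (S : SDS X N) {t T : ℝ≥0} (h : t ≤ T) :
    Measurable fun p : X × W =>
      if p.2 ∈ N.law.support then S.Λ t p.1 (N.θ (T - t) p.2) else p.1 := by
  have hc : ContinuousOn (fun p : X × W => S.Λ t p.1 (N.θ (T - t) p.2))
      {p | p.2 ∈ N.law.support} := by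
    rintro ⟨x, w⟩ hw
    have h1 := S.continuousAt_path T x w hw
    have h2 : ContinuousAt (fun f : C(Set.Icc 0 T, X) => f ⟨t, zero_le, h⟩)
      ((fun p : X × W =>
      (⟨fun t => S.Λ t p.1 (N.θ (T - t) p.2), S.continuous_path T p.1 p.2⟩ : C(Set.Icc 0 T, X)))
      (x, w)) := (continuous_eval_const _).continuousAt
    exact (ContinuousAt.comp h2 h1).continuousWithinAt
  exact hc.measurable_piecewise (g := Prod.fst) continuous_fst.continuousOn
    ((measurableSet_support N).preimage measurable_snd)

/-- Sampling condition along the realisation `u ↦ Λ_u(x, θ_{T-u} w)` of the process. -/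
def Samples (S : SDS X N) (T : ℝ≥0) (x : X) (w : W) : ℝ≥0 → List (ℝ≥0 × Set X) → Prop
  | _, [] => True
  | t, (r, A) :: l => S.Λ (t + r) x (N.θ (T - (t + r)) w) ∈ A ∧ S.Samples T x w (t + r) l

/-- The total duration of a list of increments. -/
def duration {X : Type*} (l : List (ℝ≥0 × Set X)) : ℝ≥0 := (l.map Prod.fst).sum

theorem measurableSet_samples (S : SDS X N) (T : ℝ≥0) (l : List (ℝ≥0 × Set X)) (t : ℝ≥0)
    (ht : t + duration l ≤ T) (hl : ∀ q ∈ l, MeasurableSet q.2) :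
    MeasurableSet {p : X × W | p.2 ∈ N.law.support ∧ S.Samples T p.1 p.2 t l} := by
  induction l generalizing t with
  | nil =>
    simp only [Samples, and_true]
    exact (measurableSet_support N).preimage measurable_snd
  | cons q l ih =>
    obtain ⟨r, A⟩ := q
    have hd : duration ((r, A) :: l) = r + duration l := by simp [duration]
    rw [hd, ← add_assoc] at ht
    have h1 := ih (t + r) ht (fun q hq => hl q (List.mem_cons_of_mem _ hq))
    have hA : MeasurableSet A := hl (r, A) List.mem_cons_self
    have h2 := (S.measurable_piece (le_self_add.trans ht)) hA
    convert h1.inter h2 using 1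
    ext p
    by_cases hp : p.2 ∈ N.law.support <;> simp [Samples, hp, and_comm]

theorem samples_shift (S : SDS X N) (T r : ℝ≥0) (x : X) (w : W) (l : List (ℝ≥0 × Set X))
    (t : ℝ≥0) (h : r + t + duration l ≤ T) :
    S.Samples (T - r) (S.Λ r x (N.θ (T - r) w)) w t l ↔ S.Samples T x w (r + t) l := by
  induction l generalizing t with
  | nil => simp [Samples]
  | cons q l ih =>
    obtain ⟨r', A⟩ := q
    have hd : duration ((r', A) :: l) = r' + duration l := by simp [duration]
    rw [hd, ← add_assoc] at h
    simp only [Samples]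
    rw [ih (t + r') (by rwa [← add_assoc]), ← add_assoc]
    have h1 : r + t + r' ≤ T := le_self_add.trans h
    have e1 : T - r - (t + r') = T - (r + t + r') := by rw [tsub_tsub, add_assoc]
    have e2 : T - r = (t + r') + (T - (r + t + r')) := by
      rw [← e1, add_tsub_cancel_of_le]
      exact le_tsub_of_add_le_left (by rwa [← add_assoc])
    have e3 : S.Λ (t + r') (S.Λ r x (N.θ (T - r) w)) (N.θ (T - r - (t + r')) w)
        = S.Λ (r + t + r') x (N.θ (T - (r + t + r')) w) := by
      have e4 := S.cocycle (t + r') r x (N.θ (T - (r + t + r')) w)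
      rw [← N.θ_add, ← e2, show t + r' + r = r + t + r' by ring] at e4
      rw [e1, e4]
    rw [e3]

theorem aemeasurable_of_support {μ : Measure (X × W)} (hμ : ∀ᵐ z ∂μ, z.2 ∈ N.law.support)
    {f g : X × W → ℝ≥0∞} (hg : Measurable g) (h : ∀ z : X × W, z.2 ∈ N.law.support → f z = g z) :
    AEMeasurable f μ :=
  ⟨g, hg, by filter_upwards [hμ] with z hz using h z hz⟩

theorem measurable_P (N : StationaryNoise W) (T : ℝ≥0) {E : Set (X × W)} (hE : MeasurableSet E) :
    Measurable fun z : X × W => N.P T z.2 {w' | (z.1, w') ∈ E} := by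
  have h : MeasurableSet {q : (X × W) × W | (q.1.1, q.2) ∈ E} := hE.preimage (by fun_prop)
  exact Kernel.measurable_kernel_prodMk_left (κ := (N.P T).comap Prod.snd measurable_snd) h

theorem aemeasurable_Λ (S : SDS X N) (t : ℝ≥0) (x : X) {w : W} (hw : w ∈ N.law.support) :
    AEMeasurable (fun w' => (S.Λ t x w', w')) (N.P t w) := by
  classical
  have hS : ∀ᵐ v ∂(N.P t w), v ∈ N.law.support := noise_compl_support N t hw
  refine ⟨fun w' => (if w' ∈ N.law.support then S.Λ t x (N.θ (t - t) w') else x, w'), ?_, ?_⟩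
  · exact ((S.measurable_piece le_rfl).comp (measurable_const.prodMk measurable_id)).prodMk
      measurable_id
  · filter_upwards [hS] with v hv
    simp [hv, N.θ_zero]

theorem finDimProb_eq (S : SDS X N) (l : List (ℝ≥0 × Set X)) (hl : ∀ q ∈ l, MeasurableSet q.2)
    (T : ℝ≥0) (hT : duration l ≤ T) (x : X) (w : W) (hw : w ∈ N.law.support) :
    S.finDimProb l (x, w) =
      N.P T w {w' | (x, w') ∈ {p : X × W | p.2 ∈ N.law.support ∧ S.Samples T p.1 p.2 0 l}} := by
  have hSae : ∀ t, ∀ᵐ v ∂(N.P t w), v ∈ N.law.support := fun t => noise_compl_support N t hw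
  induction l generalizing T x w with
  | nil =>
    have h : ∀ᵐ v ∂(N.P T w), v ∈ N.law.support := hSae T
    simp only [finDimProb, Samples, Set.mem_ofPred_eq, and_true]
    exact (prob_compl_eq_zero_iff (measurableSet_support N)).1 h |>.symm
  | cons q l ih =>
    obtain ⟨r, A⟩ := q
    have hd : duration ((r, A) :: l) = r + duration l := by simp [duration]
    have hA : MeasurableSet A := hl (r, A) List.mem_cons_self
    have hl' : ∀ q ∈ l, MeasurableSet q.2 := fun q hq => hl q (List.mem_cons_of_mem _ hq)
    rw [hd] at hT
    have hrT : r ≤ T := le_self_add.trans hT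
    have hT' : duration l ≤ T - r := le_tsub_of_add_le_left hT
    have ihS := fun x' w' (hw' : w' ∈ N.law.support) =>
      ih hl' (T - r) hT' x' w' hw' (fun t => noise_compl_support N t hw')
    have hE := S.measurableSet_samples T ((r, A) :: l) 0 (by simpa [hd] using hT) hl
    have hE' := S.measurableSet_samples (T - r) l 0 (by simpa using hT') hl'
    have haeΛ := S.aemeasurable_Λ r x hw
    simp only [finDimProb, Q]
    rw [lintegral_map' ?_ haeΛ]
    · have hTr : N.P T = N.P (T - r) ∘ₖ N.P r := by rw [← N.P_add, add_tsub_cancel_of_le hrT]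
      have hm : MeasurableSet {w' | (x, w') ∈ {p : X × W | p.2 ∈ N.law.support ∧
          S.Samples T p.1 p.2 0 ((r, A) :: l)}} := hE.preimage (by fun_prop)
      rw [hTr, Kernel.comp_apply' _ _ _ hm]
      refine lintegral_congr_ae ?_
      filter_upwards [hSae r] with v hv
      by_cases hvA : S.Λ r x v ∈ A
      · rw [Set.indicator_of_mem (by exact hvA), ihS _ _ hv]
        refine measure_congr ?_
        filter_upwards [noise_ae_θ N (T - r) v] with v' hv'
        refine propext (and_congr_right fun _ => ?_)
        simp only [Samples]
        rw [← hv', S.samples_shift T r x v' l 0 (by simpa using hT)]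
        simp only [zero_add, add_zero, hv', hvA, true_and]
      · rw [Set.indicator_of_notMem (by exact hvA)]
        symm
        rw [measure_eq_zero_iff_ae_notMem]
        filter_upwards [noise_ae_θ N (T - r) v] with v' hv' hmem
        have := hmem.2
        simp only [Samples, zero_add, hv'] at this
        exact hvA this.1
    · refine aemeasurable_of_support (N := N) ?_
        ((measurable_P N (T - r) hE').indicator (hA.preimage measurable_fst)) ?_
      · have : {z : X × W | z.2 ∈ N.law.support}ᶜ = Prod.snd ⁻¹' N.law.supportᶜ := rfl
        rw [ae_iff]
        have hms : MeasurableSet {z : X × W | ¬ z.2 ∈ N.law.support} :=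
          (measurableSet_support N).compl.preimage measurable_snd
        rw [Measure.map_apply_of_aemeasurable haeΛ hms]
        exact noise_compl_support N r hw
      · rintro ⟨x', w'⟩ hz
        by_cases h : x' ∈ A
        · rw [Set.indicator_of_mem (by exact h), Set.indicator_of_mem (by exact h), ihS x' w' hz]
        · rw [Set.indicator_of_notMem (by exact h), Set.indicator_of_notMem (by exact h)]

/-- One unit time step of the noise. -/
noncomputable def noiseStep (N : StationaryNoise W) (n : ℕ) :
    Kernel (Π _ : Finset.Iic n, W) W :=
  (N.P 1).comap (fun h : (Π _ : Finset.Iic n, W) => h ⟨n, by simp⟩) (by fun_prop)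

instance (N : StationaryNoise W) (n : ℕ) : IsMarkovKernel (noiseStep N n) := by
  unfold noiseStep; infer_instance

/-- The law of the noise sampled at integer times, started from `w`. -/
noncomputable def noiseChain (N : StationaryNoise W) : Kernel W (ℕ → W) :=
  (Kernel.traj (X := fun _ => W) (noiseStep N) 0).comap (fun w _ => w) (by fun_prop)

instance (N : StationaryNoise W) : IsMarkovKernel (noiseChain N) := by
  unfold noiseChain; infer_instance

theorem noiseChain_spec (N : StationaryNoise W) (w : W) (n : ℕ) :
    (noiseChain N w).map (fun ω => ω n) = N.P n w ∧
      ∀ᵐ ω ∂(noiseChain N w), N.θ 1 (ω (n + 1)) = ω n := by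
  let κ : (n : ℕ) → Kernel (Π _ : Finset.Iic n, W) W := noiseStep N
  have hκ : ∀ n, IsMarkovKernel (κ n) := fun n => by dsimp only [κ]; infer_instance
  let x₀ : Π _ : Finset.Iic 0, W := fun _ => w
  have hC : noiseChain N w = Kernel.traj (X := fun _ => W) κ 0 x₀ := rfl
  have key : ∀ n : ℕ, (Kernel.partialTraj (X := fun _ => W) κ 0 n x₀) ⊗ₘ (κ n) =
      (noiseChain N w).map (fun x ↦ (Preorder.frestrictLe (π := fun _ => W) n x, x (n + 1))) :=
    fun n => Kernel.partialTraj_compProd_eq_map_traj (X := fun _ => W) (κ := κ) (Nat.zero_le n)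
  have hlast : ∀ n : ℕ, (Kernel.partialTraj (X := fun _ => W) κ 0 n x₀).map
      (fun h => h ⟨n, by simp⟩) = (noiseChain N w).map (fun ω => ω n) := by
    intro n
    rw [hC, ← Kernel.traj_map_frestrictLe_apply, Measure.map_map (by fun_prop) (by fun_prop)]
    rfl
  constructor
  · induction n with
    | zero =>
      rw [← hlast 0]
      simp [N.P_zero, Kernel.partialTraj_self, Kernel.id_apply, x₀,
        Measure.map_dirac' (measurable_pi_apply _)]
    | succ n ih =>
      have h1 : (noiseChain N w).map (fun ω => ω (n + 1)) =
          ((noiseChain N w).map (fun x ↦ (Preorder.frestrictLe (π := fun _ => W) n x,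
            x (n + 1)))).snd := by
        rw [Measure.snd, Measure.map_map (by fun_prop) (by fun_prop)]
        rfl
      rw [h1, ← key n, Measure.snd_compProd]
      have h2 : κ n ∘ₘ (Kernel.partialTraj (X := fun _ => W) κ 0 n x₀) =
          N.P 1 ∘ₘ ((Kernel.partialTraj (X := fun _ => W) κ 0 n x₀).map
            (fun h => h ⟨n, by simp⟩)) := by
        ext s hs
        rw [Measure.bind_apply hs (Kernel.aemeasurable _), Measure.bind_apply hs
          (Kernel.aemeasurable _), lintegral_map (Kernel.measurable_coe _ hs) (by fun_prop)]
        rfl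
      rw [h2, hlast, ih, Nat.cast_succ, N.P_add]
      ext s hs
      rw [Measure.bind_apply hs (Kernel.aemeasurable _), Kernel.comp_apply' _ _ _ hs]
  · have hm : MeasurableSet {p : (Π _ : Finset.Iic n, W) × W |
        N.θ 1 p.2 = p.1 ⟨n, by simp⟩} :=
      measurableSet_eq_fun ((N.measurable_θ 1).comp measurable_snd) (by fun_prop)
    have h1 : ∀ᵐ p ∂((Kernel.partialTraj (X := fun _ => W) κ 0 n x₀) ⊗ₘ (κ n)),
        N.θ 1 p.2 = p.1 ⟨n, by simp⟩ := by
      rw [Measure.ae_compProd_iff hm]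
      exact Filter.Eventually.of_forall fun h => noise_ae_θ N 1 _
    rw [key n] at h1
    exact ae_of_ae_map (by fun_prop) h1

/-- Noise trajectories that are consistent with the semiflow and stay in the support. -/
def goodNoise (N : StationaryNoise W) : Set (ℕ → W) :=
  {ω | ∀ n, ω n ∈ N.law.support ∧ N.θ 1 (ω (n + 1)) = ω n}

theorem measurableSet_goodNoise (N : StationaryNoise W) : MeasurableSet (goodNoise N) := by
  have : goodNoise N = ⋂ n : ℕ, ((fun ω : ℕ → W => ω n) ⁻¹' N.law.support ∩
      {ω : ℕ → W | N.θ 1 (ω (n + 1)) = ω n}) := by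
    ext ω; simp [goodNoise]
  rw [this]
  refine MeasurableSet.iInter fun n => ?_
  exact ((measurableSet_support N).preimage (measurable_pi_apply n)).inter
    (measurableSet_eq_fun ((N.measurable_θ 1).comp (measurable_pi_apply _)) (measurable_pi_apply _))

theorem ae_goodNoise (N : StationaryNoise W) {w : W} (hw : w ∈ N.law.support) :
    ∀ᵐ ω ∂(noiseChain N w), ω ∈ goodNoise N := by
  refine ae_all_iff.2 fun n => Filter.Eventually.and ?_ (noiseChain_spec N w n).2
  have h : ∀ᵐ v ∂((noiseChain N w).map (fun ω => ω n)), v ∈ N.law.support := by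
    rw [(noiseChain_spec N w n).1]; exact noise_compl_support N n hw
  exact ae_of_ae_map (measurable_pi_apply n).aemeasurable h

theorem goodNoise_θ {ω : ℕ → W} (hω : ω ∈ goodNoise N) (n m : ℕ) :
    N.θ m (ω (n + m)) = ω n := by
  induction m with
  | zero => simp [N.θ_zero]
  | succ m ih =>
    rw [Nat.cast_succ, N.θ_add, ← add_assoc, (hω (n + m)).2, ih]

/-- The path driven by a noise trajectory. -/
noncomputable def pathFun (S : SDS X N) (x : X) (ω : ℕ → W) (t : ℝ≥0) : X :=
  S.Λ t x (N.θ (⌈t⌉₊ - t) (ω ⌈t⌉₊))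

theorem pathFun_eq (S : SDS X N) (x : X) {ω : ℕ → W} (hω : ω ∈ goodNoise N) {t : ℝ≥0} {n : ℕ}
    (h : t ≤ n) : S.pathFun x ω t = S.Λ t x (N.θ (n - t) (ω n)) := by
  obtain ⟨m, rfl⟩ := Nat.exists_eq_add_of_le (Nat.ceil_le.2 h)
  rw [pathFun, ← goodNoise_θ hω ⌈t⌉₊ m, ← N.θ_add]
  congr 2
  push_cast
  rw [tsub_add_eq_add_tsub (Nat.le_ceil t)]

theorem continuous_pathFun (S : SDS X N) (x : X) {ω : ℕ → W} (hω : ω ∈ goodNoise N) :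
    Continuous (S.pathFun x ω) := by
  rw [continuous_iff_continuousAt]
  intro t
  obtain ⟨n, hn⟩ := exists_nat_gt t
  have h1 : ContinuousOn (S.pathFun x ω) (Set.Icc 0 (n : ℝ≥0)) := by
    rw [continuousOn_iff_continuous_domRestrict]
    refine (S.continuous_path n x (ω n)).congr fun u => ?_
    exact (S.pathFun_eq x hω u.2.2).symm
  refine h1.continuousAt ?_
  filter_upwards [Iio_mem_nhds hn] with u hu using ⟨zero_le, hu.le⟩

open Classical in
/-- The path driven by a noise trajectory, as an element of `C(ℝ₊, X)`. -/
noncomputable def pathMap (S : SDS X N) (p : (X × W) × (ℕ → W)) : C(ℝ≥0, X) :=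
  if h : p.2 ∈ goodNoise N then ⟨S.pathFun p.1.1 p.2, S.continuous_pathFun p.1.1 h⟩
  else ContinuousMap.const _ p.1.1

theorem measurable_pathMap (S : SDS X N) : Measurable S.pathMap := by
  classical
  rw [measurable_comap_iff, measurable_pi_iff]
  intro t
  have h : (fun p : (X × W) × (ℕ → W) => S.pathMap p t) = fun p =>
      if p.2 ∈ goodNoise N then
        (if p.2 ⌈t⌉₊ ∈ N.law.support then S.Λ t p.1.1 (N.θ (⌈t⌉₊ - t) (p.2 ⌈t⌉₊)) else p.1.1)
      else p.1.1 := by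
    funext p
    by_cases h : p.2 ∈ goodNoise N
    · simp [pathMap, h, (h ⌈t⌉₊).1, pathFun]
    · simp [pathMap, h]
  change Measurable fun p : (X × W) × (ℕ → W) => S.pathMap p t
  rw [h]
  refine Measurable.ite ((measurableSet_goodNoise N).preimage measurable_snd) ?_ (by fun_prop)
  exact (S.measurable_piece (Nat.le_ceil t)).comp
    (f := fun p : (X × W) × (ℕ → W) => (p.1.1, p.2 ⌈t⌉₊)) (by fun_prop)

theorem measurableSet_pathCylinder (l : List (ℝ≥0 × Set X)) (hl : ∀ q ∈ l, MeasurableSet q.2)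
    (t : ℝ≥0) : MeasurableSet (pathCylinder t l) := by
  induction l generalizing t with
  | nil => exact MeasurableSet.univ
  | cons q l ih =>
    refine MeasurableSet.inter ?_ (ih (fun q hq => hl q (List.mem_cons_of_mem _ hq)) _)
    have : Measurable fun f : C(ℝ≥0, X) => f (t + q.1) :=
      (measurable_pi_apply (t + q.1)).comp (comap_measurable _)
    exact this (hl q List.mem_cons_self)

theorem pathMap_mem_pathCylinder (S : SDS X N) (z : X × W) {ω : ℕ → W} (hω : ω ∈ goodNoise N)
    {n : ℕ} (l : List (ℝ≥0 × Set X)) (t : ℝ≥0) (h : t + duration l ≤ n) :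
    S.pathMap (z, ω) ∈ pathCylinder t l ↔ S.Samples n z.1 (ω n) t l := by
  induction l generalizing t with
  | nil => simp [pathCylinder, Samples]
  | cons q l ih =>
    obtain ⟨r, A⟩ := q
    have hd : duration ((r, A) :: l) = r + duration l := by simp [duration]
    rw [hd, ← add_assoc] at h
    refine and_congr ?_ (ih _ h)
    change S.pathMap (z, ω) (t + r) ∈ A ↔ _
    rw [← S.pathFun_eq z.1 hω (le_self_add.trans h)]
    simp [pathMap, hω]

/-- Path laws exist, so that `pathLaw` below is the genuine law of the process generated by the
system for every generalised initial condition, and for `δ_{(x, w)}` with `w` in the support. -/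
theorem exists_isPathLaw (S : SDS X N) (μ : Measure (X × W)) [IsProbabilityMeasure μ]
    (hμ : ∀ᵐ z ∂μ, z.2 ∈ N.law.support) : ∃ ρ, S.IsPathLaw μ ρ := by
  let C : Kernel (X × W) (ℕ → W) := (noiseChain N).comap (Prod.snd : X × W → W) measurable_snd
  refine ⟨(μ ⊗ₘ C).map S.pathMap, Measure.isProbabilityMeasure_map
    S.measurable_pathMap.aemeasurable, fun l hl => ?_⟩
  have hcyl := measurableSet_pathCylinder l hl 0
  rw [Measure.map_apply S.measurable_pathMap hcyl,
    Measure.compProd_apply (S.measurable_pathMap hcyl)]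
  refine lintegral_congr_ae ?_
  obtain ⟨n, hn⟩ := exists_nat_ge (duration l)
  filter_upwards [hμ] with z hz
  rw [show S.finDimProb l z = S.finDimProb l (z.1, z.2) from rfl,
    S.finDimProb_eq l hl n hn z.1 z.2 hz, ← (noiseChain_spec N z.2 n).1,
    Measure.map_apply (by fun_prop) (show MeasurableSet {w' | (z.1, w') ∈ {p : X × W |
      p.2 ∈ N.law.support ∧ S.Samples n p.1 p.2 0 l}} from
      (S.measurableSet_samples n l 0 (by simpa using hn) hl).preimage (by fun_prop))]
  refine measure_congr ?_
  filter_upwards [ae_goodNoise N hz] with ω hω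
  refine propext ?_
  change S.pathMap (z, ω) ∈ pathCylinder 0 l ↔ ω n ∈ N.law.support ∧ S.Samples n z.1 (ω n) 0 l
  rw [S.pathMap_mem_pathCylinder z hω l 0 (by simpa using hn)]
  exact (and_iff_right (hω n).1).symm

/-- Every finite family of time marginals is described by a cylinder. -/
theorem exists_pathCylinder_eq (s : Finset ℝ≥0) (A : ℝ≥0 → Set X)
    (hA : ∀ i, MeasurableSet (A i)) (t : ℝ≥0) (ht : ∀ i ∈ s, t ≤ i) :
    ∃ l : List (ℝ≥0 × Set X), (∀ q ∈ l, MeasurableSet q.2) ∧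
      pathCylinder t l = {f | ∀ i ∈ s, f i ∈ A i} := by
  induction s using Finset.induction_on_min generalizing t with
  | empty => exact ⟨[], by simp, by simp [pathCylinder]⟩
  | insert a s ha ih =>
    obtain ⟨l, hl, h⟩ := ih a fun i hi => (ha i hi).le
    have hta : t + (a - t) = a := add_tsub_cancel_of_le (ht a (Finset.mem_insert_self a s))
    refine ⟨(a - t, A a) :: l, ?_, ?_⟩
    · intro q hq
      rcases List.mem_cons.1 hq with rfl | hq
      · exact hA a
      · exact hl q hq
    · ext f
      simp only [pathCylinder, hta, h]
      simp

/-- A given initial law has at most one path law. -/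
theorem IsPathLaw.unique {S : SDS X N} {μ : Measure (X × W)} {ρ ρ' : Measure C(ℝ≥0, X)}
    (h : S.IsPathLaw μ ρ) (h' : S.IsPathLaw μ ρ') : ρ = ρ' := by
  have := h.1
  have := h'.1
  have hpi : IsPiSystem (squareCylinders fun _ : ℝ≥0 => {A : Set X | MeasurableSet A}) :=
    isPiSystem_squareCylinders (fun _ => MeasurableSpace.isPiSystem_measurableSet)
      fun _ => MeasurableSet.univ
  refine ext_of_generate_finite _ ?_ (hpi.comap fun (f : C(ℝ≥0, X)) i => f i) ?_ (by simp)
  · change MeasurableSpace.comap _ _ = _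
    rw [← generateFrom_squareCylinders, MeasurableSpace.comap_generateFrom]
    rfl
  · rintro _ ⟨_, ⟨s, A, hA, rfl⟩, rfl⟩
    obtain ⟨l, hl, hls⟩ := exists_pathCylinder_eq (X := X) s A
      (fun i => hA i (Set.mem_univ i)) 0 (by simp)
    have : (fun (f : C(ℝ≥0, X)) i => f i) ⁻¹' (s : Set ℝ≥0).pi A = pathCylinder 0 l := by
      rw [hls]; rfl
    rw [this, h.2 l hl, h'.2 l hl]

open Classical in
/-- The law `Q̄ μ` on `C(ℝ₊, X)` of the process generated by the system from the initial law `μ`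
(it exists and is unique when the noise marginal of `μ` is carried by the support of the law of
the noise, see `exists_isPathLaw` and `IsPathLaw.unique`). -/
noncomputable def pathLaw (S : SDS X N) (μ : Measure (X × W)) : Measure C(ℝ≥0, X) :=
  if h : ∃ ρ, S.IsPathLaw μ ρ then h.choose else 0

instance (S : SDS X N) (μ : Measure (X × W)) : IsFiniteMeasure (S.pathLaw μ) := by
  unfold pathLaw
  split_ifs with h
  · have := h.choose_spec.1
    infer_instance
  · infer_instance

theorem isPathLaw_pathLaw (S : SDS X N) (μ : Measure (X × W)) [IsProbabilityMeasure μ]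
    (hμ : ∀ᵐ z ∂μ, z.2 ∈ N.law.support) : S.IsPathLaw μ (S.pathLaw μ) := by
  have h := S.exists_isPathLaw μ hμ
  rw [pathLaw, dif_pos h]
  exact h.choose_spec

/-- Two generalised initial conditions are equivalent if they generate processes with the same
law. -/
def Equivalent (S : SDS X N) (μ ν : Measure (X × W)) : Prop := S.pathLaw μ = S.pathLaw ν

/-- `R_t^* Q̄ δ_{(x, w)}`: the law of the process started from `(x, w)`, restricted to
`[t, ∞)`. -/
noncomputable def futureLaw (S : SDS X N) (t : ℝ≥0) (x : X) (w : W) :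
    Measure C(Set.Ici t, X) :=
  (S.pathLaw (Measure.dirac (x, w))).map (ContinuousMap.restrict (Set.Ici t))

instance (S : SDS X N) (t : ℝ≥0) (x : X) (w : W) : IsFiniteMeasure (S.futureLaw t x w) := by
  unfold futureLaw; infer_instance

/-- The strong Feller property at time `t`. -/
def IsStrongFellerAt (S : SDS X N) (t : ℝ≥0) : Prop :=
  ∃ ℓ : X → X → W → ℝ≥0,
    (∀ x y, ∀ w ∈ N.law.support,
      ContinuousAt (fun p : X × X × W => ℓ p.1 p.2.1 p.2.2) (x, y, w)) ∧
    (∀ x, ∀ᵐ w ∂N.law, ℓ x x w = 0) ∧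
    ∀ x y, ∀ᵐ w ∂N.law, tvNorm (S.futureLaw t x w) (S.futureLaw t y w) ≤ ℓ x y w

/-- Topological irreducibility at time `t`, with an exceptional null set of noises that is uniform
in `x` and `U`. -/
def IsTopologicallyIrreducibleAt (S : SDS X N) (t : ℝ≥0) : Prop :=
  ∀ᵐ w ∂N.law, ∀ x : X, ∀ U : Set X, IsOpen U → U.Nonempty →
    0 < S.Q t (x, w) (U ×ˢ Set.univ)

/-- The set `N^t_W` of pairs `(w, w')` of noises for which the laws of the processes started from
`(x, w)` and `(x, w')`, restricted to `[t, ∞)`, are mutually absolutely continuous for every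
`x`. -/
def equivalentNoises (S : SDS X N) (t : ℝ≥0) : Set (W × W) :=
  {p | ∀ x, S.futureLaw t x p.1 ≪ S.futureLaw t x p.2 ∧ S.futureLaw t x p.2 ≪ S.futureLaw t x p.1}

/-- Quasi-Markovian systems, where the subcouplings are only required for noises in the support of
the law of the noise. -/
def IsQuasiMarkovian (S : SDS X N) : Prop :=
  ∀ V U : Set W, IsOpen V → IsOpen U → ∀ s t : ℝ≥0, 0 < s → 0 < t →
    ∃ K : Kernel N.law.support (W × W),
      (∀ w, IsSubcoupling (K w) ((N.P s w).restrict V) ((N.P s w).restrict U)) ∧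
      ∀ w : N.law.support, 0 < min (N.P s w V) (N.P s w U) → 0 < K w (S.equivalentNoises t)

end SDS

/-! Suppose the path laws of two invariant measures `μ`, `ν` differ. Both path laws are stationary,
so they can be told apart by an event `A` that is shift invariant up to null sets: a superlevel set
of the density of one law with respect to their sum (`exists_separating_set`). No ergodic
decomposition is needed.

The probability of `A` from a starting point `z = (x, w)` is a harmonic function of `z`, hence
almost surely constant along transitions. The Markov property then makes `A` independent of every
cylinder given the starting point, so this probability is `0` or `1` (`ae_pathKernel_zero_or_one`).
Conditioning `μ` on the points where it is `1`, and `ν` on those where it is `0`, gives invariant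
measures `μ'` and `ν'` under which the future almost surely lies in `A`, respectively in its
complement. The noise marginals are still the law of the noise, by uniqueness of the latter
(`exists_invariant_ae_one`).

Since `μ'` and `ν'` have the same noise marginal, almost every noise `w` admits positions `x`, `y`
whose futures after time `s` lie on opposite sides of `A`. This is contradictory (`not_separated`).
Irreducibility lets `x` reach, at time `s`, a small ball containing a position reached from `y`. The
two noises involved may differ, but quasi-Markovianity supplies a pair of nearby noises with
equivalent futures, so one of them can be replaced by the other. Then two points of the ball have
mutually singular futures under a single noise, whereas strong Feller makes their total variation
distance small. -/

namespace SDS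

variable {X W : Type*} [TopologicalSpace X] [PolishSpace X] [MeasurableSpace X] [BorelSpace X]
  [TopologicalSpace W] [PolishSpace W] [MeasurableSpace W] [BorelSpace W] {N : StationaryNoise W}

/-! ### Shifts, cylinders and measures on path space. -/

/-- The time shift of paths. -/
def shift (t : ℝ≥0) (f : C(ℝ≥0, X)) : C(ℝ≥0, X) := f.comp ⟨fun u => t + u, by fun_prop⟩

@[simp] theorem shift_apply (t u : ℝ≥0) (f : C(ℝ≥0, X)) : shift t f u = f (t + u) := rfl

theorem measurable_path_eval {ι : Type*} [TopologicalSpace ι] (i : ι) :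
    Measurable fun f : C(ι, X) => f i :=
  (measurable_pi_apply i).comp (comap_measurable _)

theorem measurable_path_iff {ι Ω : Type*} [TopologicalSpace ι] [MeasurableSpace Ω]
    {g : Ω → C(ι, X)} : Measurable g ↔ ∀ i, Measurable fun ω => g ω i := by
  rw [measurable_comap_iff, measurable_pi_iff]
  rfl

theorem measurable_shift (t : ℝ≥0) : Measurable (shift t : C(ℝ≥0, X) → C(ℝ≥0, X)) :=
  measurable_path_iff.2 fun u => measurable_path_eval (t + u)

theorem shift_preimage_pathCylinder (t u : ℝ≥0) (l : List (ℝ≥0 × Set X)) :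
    shift t ⁻¹' pathCylinder u l = pathCylinder (t + u) l := by
  induction l generalizing u with
  | nil => rfl
  | cons q l ih =>
    simp only [pathCylinder, Set.preimage_inter, ih, Set.preimage_ofPred_eq, shift_apply, add_assoc]

theorem pathCylinder_cons (r : ℝ≥0) (B : Set X) (l : List (ℝ≥0 × Set X)) :
    pathCylinder 0 ((r, B) :: l) = {f | f r ∈ B} ∩ shift r ⁻¹' pathCylinder 0 l := by
  simp [pathCylinder, shift_preimage_pathCylinder]

/-- Finite measures on path space that agree on cylinders are equal. -/
theorem path_measure_ext {ρ ρ' : Measure C(ℝ≥0, X)} [IsFiniteMeasure ρ]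
    (h : ∀ l : List (ℝ≥0 × Set X), (∀ q ∈ l, MeasurableSet q.2) →
      ρ (pathCylinder 0 l) = ρ' (pathCylinder 0 l)) : ρ = ρ' := by
  have hpi : IsPiSystem (squareCylinders fun _ : ℝ≥0 => {A : Set X | MeasurableSet A}) :=
    isPiSystem_squareCylinders (fun _ => MeasurableSpace.isPiSystem_measurableSet)
      fun _ => MeasurableSet.univ
  refine ext_of_generate_finite _ ?_ (hpi.comap fun (f : C(ℝ≥0, X)) i => f i) ?_
    (by simpa [pathCylinder] using h [] (by simp))
  · change MeasurableSpace.comap _ _ = _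
    rw [← generateFrom_squareCylinders, MeasurableSpace.comap_generateFrom]
    rfl
  · rintro _ ⟨_, ⟨s, A, hA, rfl⟩, rfl⟩
    obtain ⟨l, hl, hls⟩ := exists_pathCylinder_eq (X := X) s A
      (fun i => hA i (Set.mem_univ i)) 0 (by simp)
    have : (fun (f : C(ℝ≥0, X)) i => f i) ⁻¹' (s : Set ℝ≥0).pi A = pathCylinder 0 l := by
      rw [hls]; rfl
    rw [this, h l hl]

/-! ### Transition probabilities and path laws as Markov kernels. -/

open Classical in
/-- A jointly measurable version of `(x, w') ↦ (Λ_t(x, w'), w')`. -/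
noncomputable def stepMap (S : SDS X N) (t : ℝ≥0) (p : (X × W) × W) : X × W :=
  (if p.2 ∈ N.law.support then S.Λ t p.1.1 (N.θ (t - t) p.2) else p.1.1, p.2)

theorem measurable_stepMap (S : SDS X N) (t : ℝ≥0) : Measurable (S.stepMap t) :=
  ((S.measurable_piece le_rfl).comp (f := fun p : (X × W) × W => (p.1.1, p.2))
    (by fun_prop)).prodMk measurable_snd

theorem stepMap_of_mem (S : SDS X N) (t : ℝ≥0) (z : X × W) {w' : W} (hw : w' ∈ N.law.support) :
    S.stepMap t (z, w') = (S.Λ t z.1 w', w') := by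
  simp [stepMap, hw, N.θ_zero]

/-- The transition probabilities as a Markov kernel. -/
noncomputable def transitionKernel (S : SDS X N) (t : ℝ≥0) : Kernel (X × W) (X × W) :=
  (Kernel.id ×ₖ (N.P t).comap Prod.snd measurable_snd).map (S.stepMap t)

instance (S : SDS X N) (t : ℝ≥0) : IsMarkovKernel (S.transitionKernel t) :=
  Kernel.IsMarkovKernel.map _ (S.measurable_stepMap t)

theorem transitionKernel_apply (S : SDS X N) (t : ℝ≥0) (z : X × W) :
    S.transitionKernel t z = (N.P t z.2).map fun w' => S.stepMap t (z, w') := by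
  rw [transitionKernel, Kernel.map_apply _ (S.measurable_stepMap t), Kernel.prod_apply,
    Kernel.id_apply, Measure.dirac_prod, Kernel.comap_apply,
    Measure.map_map (S.measurable_stepMap t) (by fun_prop)]
  rfl

theorem ae_mem_support (N : StationaryNoise W) (t : ℝ≥0) {w : W} (hw : w ∈ N.law.support) :
    ∀ᵐ w' ∂(N.P t w), w' ∈ N.law.support := noise_compl_support N t hw

/-- The noise started in the support stays there almost surely, and there `stepMap` takes the true
value. This lets kernel calculus replace `Q`, whose measurability in `z` is not given. -/
theorem transitionKernel_eq (S : SDS X N) (t : ℝ≥0) {z : X × W} (hz : z.2 ∈ N.law.support) :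
    S.transitionKernel t z = S.Q t z := by
  rw [transitionKernel_apply, Q]
  refine Measure.map_congr ?_
  filter_upwards [ae_mem_support N t hz] with w' hw' using S.stepMap_of_mem t z hw'

theorem transitionKernel_map_snd (S : SDS X N) (t : ℝ≥0) (z : X × W) :
    (S.transitionKernel t z).map Prod.snd = N.P t z.2 := by
  rw [transitionKernel_apply, Measure.map_map measurable_snd
    (show Measurable fun w' => S.stepMap t (z, w') from
      (S.measurable_stepMap t).comp (by fun_prop))]
  exact Measure.map_id

theorem ae_transitionKernel_mem_support (S : SDS X N) (t : ℝ≥0) {z : X × W}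
    (hz : z.2 ∈ N.law.support) : ∀ᵐ z' ∂(S.transitionKernel t z), z'.2 ∈ N.law.support := by
  refine ae_of_ae_map (f := Prod.snd) (p := fun w => w ∈ N.law.support)
    measurable_snd.aemeasurable ?_
  rw [transitionKernel_map_snd]
  exact ae_mem_support N t hz

/-- The laws of the paths started from a point. -/
noncomputable def pathKernel (S : SDS X N) : Kernel (X × W) C(ℝ≥0, X) :=
  (Kernel.id ×ₖ (noiseChain N).comap Prod.snd measurable_snd).map S.pathMap

instance (S : SDS X N) : IsMarkovKernel S.pathKernel :=
  Kernel.IsMarkovKernel.map _ S.measurable_pathMap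

theorem pathKernel_apply (S : SDS X N) (z : X × W) :
    S.pathKernel z = (noiseChain N z.2).map fun ω => S.pathMap (z, ω) := by
  rw [pathKernel, Kernel.map_apply _ S.measurable_pathMap, Kernel.prod_apply,
    Kernel.id_apply, Measure.dirac_prod, Kernel.comap_apply,
    Measure.map_map S.measurable_pathMap (by fun_prop)]
  rfl

/-- At an integer time `n` beyond all sampling times, the noise `ω n` determines its own past
through the semiflow, hence the whole sampled path. The cylinder thus becomes an event for `N.P n`,
as in `finDimProb_eq`. -/
theorem pathKernel_pathCylinder (S : SDS X N) {z : X × W} (hz : z.2 ∈ N.law.support)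
    (l : List (ℝ≥0 × Set X)) (hl : ∀ q ∈ l, MeasurableSet q.2) :
    S.pathKernel z (pathCylinder 0 l) = S.finDimProb l z := by
  obtain ⟨n, hn⟩ := exists_nat_ge (duration l)
  rw [pathKernel_apply, Measure.map_apply (show Measurable fun ω => S.pathMap (z, ω) from
      S.measurable_pathMap.comp (by fun_prop))
    (measurableSet_pathCylinder l hl 0), show S.finDimProb l z = S.finDimProb l (z.1, z.2) from rfl,
    S.finDimProb_eq l hl n hn z.1 z.2 hz, ← (noiseChain_spec N z.2 n).1,
    Measure.map_apply (by fun_prop) (show MeasurableSet {w' | (z.1, w') ∈ {p : X × W |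
      p.2 ∈ N.law.support ∧ S.Samples n p.1 p.2 0 l}} from
      (S.measurableSet_samples n l 0 (by simpa using hn) hl).preimage (by fun_prop))]
  refine measure_congr ?_
  filter_upwards [ae_goodNoise N hz] with ω hω
  refine propext ?_
  change S.pathMap (z, ω) ∈ pathCylinder 0 l ↔ ω n ∈ N.law.support ∧ S.Samples n z.1 (ω n) 0 l
  rw [S.pathMap_mem_pathCylinder z hω l 0 (by simpa using hn)]
  exact (and_iff_right (hω n).1).symm

/-- By uniqueness of path laws, the chosen measure `pathLaw` may be traded for a mixture of a
measurable kernel; all later work is with `pathKernel`. -/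
theorem pathLaw_eq (S : SDS X N) (μ : Measure (X × W)) [IsProbabilityMeasure μ]
    (hμ : ∀ᵐ z ∂μ, z.2 ∈ N.law.support) : S.pathLaw μ = S.pathKernel ∘ₘ μ := by
  refine (S.isPathLaw_pathLaw μ hμ).unique ⟨inferInstance, fun l hl => ?_⟩
  rw [Measure.bind_apply (measurableSet_pathCylinder l hl 0) (Kernel.aemeasurable _)]
  refine lintegral_congr_ae ?_
  filter_upwards [hμ] with z hz using S.pathKernel_pathCylinder hz l hl

theorem pathLaw_dirac (S : SDS X N) {z : X × W} (hz : z.2 ∈ N.law.support) :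
    S.pathLaw (Measure.dirac z) = S.pathKernel z := by
  have h : MeasurableSet {z : X × W | z.2 ∈ N.law.support} :=
    (measurableSet_support N).preimage measurable_snd
  rw [S.pathLaw_eq (Measure.dirac z) ((ae_dirac_iff h).2 hz),
    Measure.dirac_bind (Kernel.measurable _)]

/-! ### Markov property and stationarity of path laws. -/

/-- The simple Markov property. -/
theorem pathKernel_markov (S : SDS X N) {z : X × W} (hz : z.2 ∈ N.law.support) (r : ℝ≥0)
    {B : Set X} (hB : MeasurableSet B) {A : Set C(ℝ≥0, X)} (hA : MeasurableSet A) :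
    S.pathKernel z ({f | f r ∈ B} ∩ shift r ⁻¹' A) =
      ∫⁻ z' in Prod.fst ⁻¹' B, S.pathKernel z' A ∂(S.transitionKernel r z) := by
  have hB' : MeasurableSet (Prod.fst ⁻¹' B : Set (X × W)) := hB.preimage measurable_fst
  -- As functions of `A`, both sides are finite measures. On a cylinder their equality is exactly
  -- the recursion defining `finDimProb`, with first step `(r, B)`.
  have key : ((S.pathKernel z).restrict {f | f r ∈ B}).map (shift r) =
      S.pathKernel ∘ₘ ((S.transitionKernel r z).restrict (Prod.fst ⁻¹' B)) := by
    refine path_measure_ext fun l hl => ?_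
    have hC := measurableSet_pathCylinder l hl 0
    rw [Measure.map_apply (measurable_shift r) hC,
      Measure.restrict_apply (hC.preimage (measurable_shift r)),
      Measure.bind_apply hC (Kernel.aemeasurable _), Set.inter_comm, ← pathCylinder_cons,
      S.pathKernel_pathCylinder hz _ (by simpa using ⟨hB, by simpa using hl⟩), finDimProb,
      ← S.transitionKernel_eq r hz, lintegral_indicator hB']
    refine lintegral_congr_ae (ae_restrict_of_ae ?_)
    filter_upwards [S.ae_transitionKernel_mem_support r hz] with z' hz'
    exact (S.pathKernel_pathCylinder hz' l hl).symm
  have h := congrArg (fun m => m A) key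
  rwa [Measure.map_apply (measurable_shift r) hA,
    Measure.restrict_apply (hA.preimage (measurable_shift r)), Set.inter_comm,
    Measure.bind_apply hA (Kernel.aemeasurable _)] at h

theorem pathKernel_shift (S : SDS X N) {z : X × W} (hz : z.2 ∈ N.law.support) (r : ℝ≥0)
    {A : Set C(ℝ≥0, X)} (hA : MeasurableSet A) :
    S.pathKernel z (shift r ⁻¹' A) = ∫⁻ z', S.pathKernel z' A ∂(S.transitionKernel r z) := by
  simpa using S.pathKernel_markov hz r MeasurableSet.univ hA

theorem IsGeneralisedInitialCondition.ae_mem_support {S : SDS X N} {μ : Measure (X × W)}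
    (hμ : S.IsGeneralisedInitialCondition μ) : ∀ᵐ z ∂μ, z.2 ∈ N.law.support := by
  refine ae_of_ae_map (f := Prod.snd) (p := fun w => w ∈ N.law.support)
    measurable_snd.aemeasurable ?_
  rw [hμ.2]
  exact Measure.support_mem_ae

theorem IsInvariantMeasure.transitionKernel {S : SDS X N} {μ : Measure (X × W)}
    (hμ : S.IsInvariantMeasure μ) (t : ℝ≥0) : S.transitionKernel t ∘ₘ μ = μ := by
  conv_rhs => rw [← hμ.2 t]
  refine Measure.bind_congr_right ?_
  filter_upwards [hμ.1.ae_mem_support] with z hz using S.transitionKernel_eq t hz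

theorem IsInvariantMeasure.map_shift {S : SDS X N} {μ : Measure (X × W)}
    (hμ : S.IsInvariantMeasure μ) (t : ℝ≥0) :
    (S.pathKernel ∘ₘ μ).map (shift t) = S.pathKernel ∘ₘ μ := by
  ext A hA
  rw [Measure.map_apply (measurable_shift t) hA,
    Measure.bind_apply (hA.preimage (measurable_shift t)) (Kernel.aemeasurable _)]
  conv_rhs => rw [← hμ.transitionKernel t]
  rw [Measure.bind_apply hA (Kernel.aemeasurable _),
    Measure.lintegral_bind (Kernel.aemeasurable _) (Kernel.measurable_coe _ hA).aemeasurable]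
  refine lintegral_congr_ae ?_
  filter_upwards [hμ.1.ae_mem_support] with z hz using S.pathKernel_shift hz t hA

end SDS

/-! ### Square-integral arguments: separating sets and harmonic functions. -/

section Auxiliary

/-- The integral of `(a - b) ^ 2` vanishes. It is applied below to a function and its image under a
dynamics that preserves the measure. -/
theorem ae_eq_of_integral_mul_self_eq {Ω : Type*} [MeasurableSpace Ω] {π : Measure Ω}
    [IsFiniteMeasure π] {a b : Ω → ℝ} (ha : AEStronglyMeasurable a π)
    (hb : AEStronglyMeasurable b π) (ha1 : ∀ᵐ ω ∂π, ‖a ω‖ ≤ 1) (hb1 : ∀ᵐ ω ∂π, ‖b ω‖ ≤ 1)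
    (haa : ∫ ω, a ω * a ω ∂π = ∫ ω, a ω * b ω ∂π)
    (hbb : ∫ ω, b ω * b ω ∂π = ∫ ω, a ω * b ω ∂π) : a =ᵐ[π] b := by
  have ia : Integrable (fun ω => a ω * a ω) π := by
    refine .of_bound (ha.mul ha) 1 ?_
    filter_upwards [ha1] with ω h
    rw [norm_mul]; exact mul_le_one₀ h (norm_nonneg _) h
  have ib : Integrable (fun ω => b ω * b ω) π := by
    refine .of_bound (hb.mul hb) 1 ?_
    filter_upwards [hb1] with ω h
    rw [norm_mul]; exact mul_le_one₀ h (norm_nonneg _) h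
  have iab : Integrable (fun ω => a ω * b ω) π := by
    refine .of_bound (ha.mul hb) 1 ?_
    filter_upwards [ha1, hb1] with ω h h'
    rw [norm_mul]; exact mul_le_one₀ h (norm_nonneg _) h'
  have e : (fun ω => (a ω - b ω) * (a ω - b ω)) =
      fun ω => (a ω * a ω - a ω * b ω) + (b ω * b ω - a ω * b ω) := by
    funext ω; ring
  have i1 : Integrable (fun ω => a ω * a ω - a ω * b ω) π := ia.sub iab
  have i2 : Integrable (fun ω => b ω * b ω - a ω * b ω) π := ib.sub iab
  have h0 : ∫ ω, (a ω - b ω) * (a ω - b ω) ∂π = 0 := by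
    rw [e, integral_add i1 i2, integral_sub ia iab, integral_sub ib iab, haa, hbb]
    ring
  rw [integral_eq_zero_iff_of_nonneg (fun ω => mul_self_nonneg _) (e ▸ i1.add i2)] at h0
  filter_upwards [h0] with ω hω
  exact sub_eq_zero.1 (mul_self_eq_zero.1 hω)

/-- Two distinct probability measures are distinguished by a set which is invariant under all
transformations that preserve both of them. -/
theorem exists_separating_set {Ω : Type*} [MeasurableSpace Ω] {ρ₁ ρ₂ : Measure Ω}
    [IsProbabilityMeasure ρ₁] [IsProbabilityMeasure ρ₂] (hne : ρ₁ ≠ ρ₂) :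
    ∃ A, MeasurableSet A ∧ ρ₁ A ≠ 0 ∧ ρ₂ Aᶜ ≠ 0 ∧ ∀ T : Ω → Ω, Measurable T →
      ρ₁.map T = ρ₁ → ρ₂.map T = ρ₂ → T ⁻¹' A =ᵐ[ρ₁ + ρ₂] A := by
  set ρ := ρ₁ + ρ₂ with hρ
  have hle : ρ₁ ≤ ρ := Measure.le_add_right le_rfl
  have hac : ρ₁ ≪ ρ := Measure.absolutelyContinuous_of_le hle
  set g := ρ₁.rnDeriv ρ with hg
  have hgm : Measurable g := Measure.measurable_rnDeriv _ _
  have hg1 : g ≤ᵐ[ρ] 1 := Measure.rnDeriv_le_one_of_le hle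
  have hgd : ∀ s, ∫⁻ x in s, g x ∂ρ = ρ₁ s := Measure.setLIntegral_rnDeriv hac
  have hA : MeasurableSet {x | 2⁻¹ < g x} := measurableSet_lt measurable_const hgm
  have hle_of : ∀ {m m' : Measure Ω} [IsProbabilityMeasure m] [IsProbabilityMeasure m'],
      m ≤ m' → m = m' := fun h => Measure.eq_of_le_of_measure_univ_eq h (by simp)
  refine ⟨{x | 2⁻¹ < g x}, hA, fun h0 => hne ?_, fun h0 => hne ?_, fun T hT h1 h2 => ?_⟩
  -- If `ρ₁` does not charge the set, the density is at most `1/2`, so `ρ₁ ≤ ρ₂`; equal masses force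
  -- equality. The next case is symmetric.
  · have h3 : ∀ᵐ x ∂ρ, g x ≤ 2⁻¹ := by
      rw [← hgd, lintegral_eq_zero_iff hgm] at h0
      rw [Filter.EventuallyEq, ae_restrict_iff' hA] at h0
      filter_upwards [h0] with x hx
      by_contra! hlt
      have := hx hlt
      rw [this] at hlt
      simp at hlt
    refine hle_of (Measure.le_iff.2 fun s hs => ?_)
    have h4 : ρ₁ s ≤ 2⁻¹ * (ρ₁ s + ρ₂ s) := by
      rw [← Measure.add_apply, ← hρ, ← hgd, ← setLIntegral_const]
      exact lintegral_mono_ae (ae_restrict_of_ae h3)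
    rw [mul_add] at h4
    have h5 : 2⁻¹ * ρ₁ s + 2⁻¹ * ρ₁ s ≤ 2⁻¹ * ρ₁ s + 2⁻¹ * ρ₂ s := by
      rwa [← add_mul, ENNReal.inv_two_add_inv_two, one_mul]
    have h6 := ENNReal.le_of_add_le_add_left
      (ENNReal.mul_ne_top (by simp) (measure_ne_top _ _)) h5
    exact (ENNReal.mul_le_mul_iff_right (by simp) (by simp)).1 h6
  · have h3 : ∀ᵐ x ∂ρ, 2⁻¹ ≤ g x := by
      have h4 : ∫⁻ x in {x | 2⁻¹ < g x}ᶜ, g x ∂ρ = ρ {x | 2⁻¹ < g x}ᶜ := by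
        rw [hgd, hρ, Measure.add_apply, h0, add_zero]
      have h5 : ρ {x | 2⁻¹ < g x}ᶜ ≤ 2⁻¹ * ρ {x | 2⁻¹ < g x}ᶜ := by
        conv_lhs => rw [← h4]
        rw [← setLIntegral_const]
        exact setLIntegral_mono measurable_const fun x hx => not_lt.1 hx
      have h6 : ρ {x | 2⁻¹ < g x}ᶜ = 0 := by
        by_contra hpos
        have h7 := (ENNReal.mul_lt_mul_iff_left hpos (measure_ne_top ρ _)).2 (ENNReal.inv_lt_one.2 ENNReal.one_lt_two)
        rw [one_mul] at h7
        exact absurd h5 (not_le.2 h7)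
      filter_upwards [compl_mem_ae_iff.2 h6] with x hx
      simpa using (not_not.1 hx : 2⁻¹ < g x).le
    refine (hle_of (Measure.le_iff.2 fun s hs => ?_)).symm
    have h4 : 2⁻¹ * (ρ₁ s + ρ₂ s) ≤ ρ₁ s := by
      rw [← Measure.add_apply, ← hρ, ← hgd s, ← setLIntegral_const]
      exact lintegral_mono_ae (ae_restrict_of_ae h3)
    rw [mul_add] at h4
    have h5 : 2⁻¹ * ρ₁ s + 2⁻¹ * ρ₂ s ≤ 2⁻¹ * ρ₁ s + 2⁻¹ * ρ₁ s := by
      rwa [← add_mul, ENNReal.inv_two_add_inv_two, one_mul]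
    have h6 := ENNReal.le_of_add_le_add_left
      (ENNReal.mul_ne_top (by simp) (measure_ne_top _ _)) h5
    exact (ENNReal.mul_le_mul_iff_right (by simp) (by simp)).1 h6
  -- Invariance of `ρ₁` and of `ρ` gives `f` and `f ∘ T` the same square integral as their mixed
  -- integral, so the density is `T`-invariant almost everywhere, and so are its superlevel sets.
  · have hρT : ρ.map T = ρ := by rw [hρ, Measure.map_add _ _ hT, h1, h2]
    let f : Ω → ℝ := fun x => (g x).toReal
    have hfm : Measurable f := hgm.ennreal_toReal
    have hf1 : ∀ᵐ x ∂ρ, ‖f x‖ ≤ 1 := by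
      filter_upwards [hg1] with x hx
      rw [Real.norm_of_nonneg ENNReal.toReal_nonneg]
      exact ENNReal.toReal_le_of_le_ofReal zero_le_one (by simpa using hx)
    have hfT1 : ∀ᵐ x ∂ρ, ‖f (T x)‖ ≤ 1 :=
      ae_of_ae_map (p := fun x => ‖f x‖ ≤ 1) hT.aemeasurable (by rwa [hρT])
    have e1 : ∫ x, f x * f x ∂ρ = ∫ x, f x ∂ρ₁ := integral_toReal_rnDeriv_mul hac
    have e2 : ∫ x, f x * f (T x) ∂ρ = ∫ x, f x ∂ρ₁ := by
      have : ∫ x, f x * f (T x) ∂ρ = ∫ x, f (T x) ∂ρ₁ := integral_toReal_rnDeriv_mul hac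
      rw [this, ← integral_map hT.aemeasurable hfm.aestronglyMeasurable, h1]
    have e3 : ∫ x, f (T x) * f (T x) ∂ρ = ∫ x, f x ∂ρ₁ := by
      rw [← e1]
      conv_rhs => rw [← hρT]
      exact (integral_map (f := fun x => f x * f x) hT.aemeasurable
        (hfm.mul hfm).aestronglyMeasurable).symm
    have hff := ae_eq_of_integral_mul_self_eq (π := ρ) (a := f) (b := fun x => f (T x))
      hfm.aestronglyMeasurable (hfm.comp hT).aestronglyMeasurable hf1 hfT1
      (by rw [e1, e2]) (by rw [e3, e2])
    have hgT1 : ∀ᵐ x ∂ρ, g (T x) ≤ 1 :=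
      ae_of_ae_map (p := fun x => g x ≤ 1) hT.aemeasurable (by rwa [hρT])
    filter_upwards [hff, hg1, hgT1] with x hx h3 h4
    refine propext ?_
    have h5 : g x = g (T x) := (ENNReal.toReal_eq_toReal_iff' (ne_top_of_le_ne_top
      ENNReal.one_ne_top h3) (ne_top_of_le_ne_top ENNReal.one_ne_top h4)).1 hx
    change 2⁻¹ < g (T x) ↔ 2⁻¹ < g x
    rw [h5]

/-- A bounded function which is harmonic almost everywhere for an invariant measure is almost
surely preserved by the transitions. -/
theorem ae_eq_of_harmonic {Z : Type*} [MeasurableSpace Z] {κ : Kernel Z Z} [IsMarkovKernel κ]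
    {μ : Measure Z} [IsFiniteMeasure μ] (hμ : κ ∘ₘ μ = μ) {h : Z → ℝ} (hm : Measurable h)
    (h1 : ∀ z, ‖h z‖ ≤ 1) (hh : ∀ᵐ z ∂μ, ∫ z', h z' ∂(κ z) = h z) :
    ∀ᵐ z ∂μ, ∀ᵐ z' ∂(κ z), h z' = h z := by
  have hsnd : (μ ⊗ₘ κ).map Prod.snd = μ := by
    conv_rhs => rw [← hμ]
    exact Measure.snd_compProd μ κ
  have hfst : (μ ⊗ₘ κ).map Prod.fst = μ := Measure.fst_compProd μ κ
  have eb : ∫ p, h p.2 * h p.2 ∂(μ ⊗ₘ κ) = ∫ z, h z * h z ∂μ := by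
    conv_rhs => rw [← hsnd]
    exact (integral_map (f := fun z => h z * h z) measurable_snd.aemeasurable
      (hm.mul hm).aestronglyMeasurable).symm
  have ea : ∫ p, h p.1 * h p.1 ∂(μ ⊗ₘ κ) = ∫ z, h z * h z ∂μ := by
    conv_rhs => rw [← hfst]
    exact (integral_map (f := fun z => h z * h z) measurable_fst.aemeasurable
      (hm.mul hm).aestronglyMeasurable).symm
  have m1 : Measurable fun p : Z × Z => h p.1 := hm.comp measurable_fst
  have m2 : Measurable fun p : Z × Z => h p.2 := hm.comp measurable_snd
  -- Harmonicity enters here: given `p.1`, the mean of `h p.2` is `h p.1`.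
  have eab : ∫ p, h p.1 * h p.2 ∂(μ ⊗ₘ κ) = ∫ z, h z * h z ∂μ := by
    rw [Measure.integral_compProd]
    · refine integral_congr_ae ?_
      filter_upwards [hh] with z hz
      rw [integral_const_mul, hz]
    · refine .of_bound (m1.mul m2).aestronglyMeasurable 1 (ae_of_all _ fun p => ?_)
      rw [norm_mul]
      exact mul_le_one₀ (h1 _) (norm_nonneg _) (h1 _)
  have := ae_eq_of_integral_mul_self_eq (π := μ ⊗ₘ κ) m1.aestronglyMeasurable
    m2.aestronglyMeasurable (ae_of_all _ fun p => h1 _) (ae_of_all _ fun p => h1 _)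
    (by rw [ea, eab]) (by rw [eb, eab])
  have := Measure.ae_ae_of_ae_compProd this
  filter_upwards [this] with z hz
  filter_upwards [hz] with z' hz' using hz'.symm

end Auxiliary

/-! ### Zero-one law for shift invariant events. -/

namespace SDS

variable {X W : Type*} [TopologicalSpace X] [PolishSpace X] [MeasurableSpace X] [BorelSpace X]
  [TopologicalSpace W] [PolishSpace W] [MeasurableSpace W] [BorelSpace W] {N : StationaryNoise W}

/-- By the Markov property, averaging the probability of `A` over a transition of length `t` gives
the probability of `shift t ⁻¹' A`; the hypothesis thus says that this function is harmonic. -/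
theorem ae_pathKernel_eq (S : SDS X N) {μ : Measure (X × W)} (hμ : S.IsInvariantMeasure μ)
    {A : Set C(ℝ≥0, X)} (hA : MeasurableSet A) (t : ℝ≥0)
    (hs : ∀ᵐ z ∂μ, S.pathKernel z (shift t ⁻¹' A) = S.pathKernel z A) :
    ∀ᵐ z ∂μ, ∀ᵐ z' ∂(S.transitionKernel t z), S.pathKernel z' A = S.pathKernel z A := by
  have := hμ.1.1
  have hm : Measurable fun z => S.pathKernel z A := Kernel.measurable_coe _ hA
  have h1 := ae_eq_of_harmonic (hμ.transitionKernel t) (h := fun z => (S.pathKernel z A).toReal)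
    hm.ennreal_toReal (fun z => ?_) ?_
  · filter_upwards [h1] with z hz
    filter_upwards [hz] with z' hz'
    exact (ENNReal.toReal_eq_toReal_iff' (measure_ne_top _ _) (measure_ne_top _ _)).1 hz'
  · rw [Real.norm_of_nonneg ENNReal.toReal_nonneg]
    exact ENNReal.toReal_le_of_le_ofReal zero_le_one (by simpa using prob_le_one)
  · filter_upwards [hs, hμ.1.ae_mem_support] with z hz hzs
    rw [integral_toReal hm.aemeasurable (ae_of_all _ fun z => measure_lt_top _ _),
      ← S.pathKernel_shift hzs t hA, hz]

/-- Shift invariant events are almost surely decided by the initial condition. -/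
theorem ae_pathKernel_zero_or_one (S : SDS X N) {μ : Measure (X × W)}
    (hμ : S.IsInvariantMeasure μ) {A : Set C(ℝ≥0, X)} (hA : MeasurableSet A)
    (hs : ∀ t, shift t ⁻¹' A =ᵐ[S.pathKernel ∘ₘ μ] A) :
    ∀ᵐ z ∂μ, S.pathKernel z A = 0 ∨ S.pathKernel z A = 1 := by
  have := hμ.1.1
  have hm : Measurable fun z => S.pathKernel z A := Kernel.measurable_coe _ hA
  have hsz : ∀ t, ∀ᵐ z ∂μ, shift t ⁻¹' A =ᵐ[S.pathKernel z] A := fun t =>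
    Measure.ae_ae_of_ae_comp (hs t)
  have hconst : ∀ t, ∀ᵐ z ∂μ, ∀ᵐ z' ∂(S.transitionKernel t z),
      S.pathKernel z' A = S.pathKernel z A := fun t =>
    S.ae_pathKernel_eq hμ hA t ((hsz t).mono fun z hz => measure_congr hz)
  -- Given the starting point, `A` is independent of each cylinder. In the induction, `A` is first
  -- replaced by its shift by `r`; the Markov property then moves the start to time `r`, where the
  -- probability of `A` is unchanged.
  have hcyl : ∀ l : List (ℝ≥0 × Set X), (∀ q ∈ l, MeasurableSet q.2) →
      ∀ᵐ z ∂μ, S.pathKernel z (pathCylinder 0 l ∩ A) =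
        S.pathKernel z A * S.pathKernel z (pathCylinder 0 l) := by
    intro l hl
    induction l with
    | nil => simp [pathCylinder]
    | cons q l ih =>
      obtain ⟨r, B⟩ := q
      have hB : MeasurableSet B := hl (r, B) List.mem_cons_self
      have hl' : ∀ q ∈ l, MeasurableSet q.2 := fun q hq => hl q (List.mem_cons_of_mem _ hq)
      have hC := measurableSet_pathCylinder l hl' 0
      have ih' : ∀ᵐ z ∂μ, ∀ᵐ z' ∂(S.transitionKernel r z),
          S.pathKernel z' (pathCylinder 0 l ∩ A) =
            S.pathKernel z' A * S.pathKernel z' (pathCylinder 0 l) :=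
        Measure.ae_ae_of_ae_comp (by rw [hμ.transitionKernel r]; exact ih hl')
      filter_upwards [ih', hconst r, hsz r, hμ.1.ae_mem_support] with z h1 h2 h3 hz
      have e1 : S.pathKernel z (pathCylinder 0 ((r, B) :: l) ∩ A) =
          S.pathKernel z ({f | f r ∈ B} ∩ shift r ⁻¹' (pathCylinder 0 l ∩ A)) := by
        rw [pathCylinder_cons, Set.preimage_inter, ← Set.inter_assoc]
        exact measure_congr ((Filter.EventuallyEq.refl _ _).inter h3.symm)
      rw [e1, S.pathKernel_markov hz r hB (hC.inter hA), pathCylinder_cons,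
        S.pathKernel_markov hz r hB hC,
        ← lintegral_const_mul _ (Kernel.measurable_coe _ hC)]
      refine lintegral_congr_ae (ae_restrict_of_ae ?_)
      filter_upwards [h1, h2] with z' h4 h5
      rw [h4, h5]
  -- The null set in `hcyl` depends on the cylinder, so the identity is integrated against `μ`
  -- before being extended from cylinders to all events. Applied to `A` itself it gives `hint`,
  -- which forces the values `0` and `1`.
  have hrestrict : (S.pathKernel ∘ₘ μ).restrict A =
      S.pathKernel ∘ₘ (μ.withDensity fun z => S.pathKernel z A) := by
    refine path_measure_ext fun l hl => ?_
    have hC := measurableSet_pathCylinder l hl 0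
    rw [Measure.restrict_apply hC, Measure.bind_apply (hC.inter hA) (Kernel.aemeasurable _),
      Measure.bind_apply hC (Kernel.aemeasurable _),
      lintegral_withDensity_eq_lintegral_mul _ hm (Kernel.measurable_coe _ hC)]
    exact lintegral_congr_ae (hcyl l hl)
  have hint : ∫⁻ z, S.pathKernel z A ∂μ = ∫⁻ z, S.pathKernel z A * S.pathKernel z A ∂μ := by
    have h := congrArg (fun m => m A) hrestrict
    rwa [Measure.restrict_apply hA, Set.inter_self, Measure.bind_apply hA (Kernel.aemeasurable _),
      Measure.bind_apply hA (Kernel.aemeasurable _),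
      lintegral_withDensity_eq_lintegral_mul _ hm hm] at h
  have hle : ∀ z, S.pathKernel z A * S.pathKernel z A ≤ S.pathKernel z A := fun z =>
    mul_le_of_le_one_left' prob_le_one
  have hfin : ∫⁻ z, S.pathKernel z A * S.pathKernel z A ∂μ ≠ ∞ := by
    rw [← hint, ← Measure.bind_apply hA (Kernel.aemeasurable _)]
    exact measure_ne_top _ _
  have hae := ae_eq_of_ae_le_of_lintegral_le (ae_of_all μ hle) hfin hm.aemeasurable hint.le
  filter_upwards [hae] with z hz
  by_cases h0 : S.pathKernel z A = 0
  · exact Or.inl h0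
  · refine Or.inr ?_
    have h1 : S.pathKernel z A * S.pathKernel z A = S.pathKernel z A * 1 := by rw [hz, mul_one]
    exact (ENNReal.mul_right_inj h0 (measure_ne_top _ _)).1 h1

/-- A shift invariant event of positive probability has probability one under another invariant
probability measure with the same noise marginal. -/
theorem exists_invariant_ae_one (S : SDS X N) {μ : Measure (X × W)} (hμ : S.IsInvariantMeasure μ)
    {A : Set C(ℝ≥0, X)} (hA : MeasurableSet A)
    (hs : ∀ t, shift t ⁻¹' A =ᵐ[S.pathKernel ∘ₘ μ] A) (hpos : (S.pathKernel ∘ₘ μ) A ≠ 0) :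
    ∃ μ' : Measure (X × W), IsProbabilityMeasure μ' ∧ μ'.map Prod.snd = N.law ∧
      (∀ t, S.transitionKernel t ∘ₘ μ' = μ') ∧
      ∀ t, ∀ᵐ z ∂μ', S.pathKernel z (shift t ⁻¹' Aᶜ) = 0 := by
  have := hμ.1.1
  have hm : Measurable fun z => S.pathKernel z A := Kernel.measurable_coe _ hA
  set B : Set (X × W) := {z | S.pathKernel z A = 1} with hB
  have hBm : MeasurableSet B := hm (measurableSet_singleton 1)
  have hsz : ∀ t, ∀ᵐ z ∂μ, shift t ⁻¹' A =ᵐ[S.pathKernel z] A := fun t =>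
    Measure.ae_ae_of_ae_comp (hs t)
  have hconst : ∀ t, ∀ᵐ z ∂μ, ∀ᵐ z' ∂(S.transitionKernel t z),
      S.pathKernel z' A = S.pathKernel z A := fun t =>
    S.ae_pathKernel_eq hμ hA t ((hsz t).mono fun z hz => measure_congr hz)
  have hBpos : μ B ≠ 0 := by
    intro h0
    apply hpos
    rw [Measure.bind_apply hA (Kernel.aemeasurable _), lintegral_eq_zero_iff hm]
    filter_upwards [S.ae_pathKernel_zero_or_one hμ hA hs, compl_mem_ae_iff.2 h0] with z h1 h2
    exact h1.resolve_right h2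
  -- Transitions almost surely neither leave `B` nor enter it from outside.
  have hinv : ∀ t, S.transitionKernel t ∘ₘ (μ.restrict B) = μ.restrict B := by
    intro t
    ext D hD
    rw [Measure.bind_apply hD (Kernel.aemeasurable _), Measure.restrict_apply hD,
      ← lintegral_indicator hBm]
    conv_rhs => rw [← hμ.transitionKernel t]
    rw [Measure.bind_apply (hD.inter hBm) (Kernel.aemeasurable _)]
    refine lintegral_congr_ae ?_
    filter_upwards [hconst t] with z hz
    by_cases hzB : z ∈ B
    · rw [Set.indicator_of_mem hzB]
      refine measure_congr ?_
      filter_upwards [hz] with z' hz'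
      refine propext (iff_self_and.2 fun _ => ?_)
      change S.pathKernel z' A = 1
      rw [hz']; exact hzB
    · rw [Set.indicator_of_notMem hzB]
      symm
      rw [measure_eq_zero_iff_ae_notMem]
      filter_upwards [hz] with z' hz' hmem
      exact hzB (hz' ▸ hmem.2 : S.pathKernel z A = 1)
  set μ' : Measure (X × W) := (μ B)⁻¹ • μ.restrict B with hμ'
  have hprob : IsProbabilityMeasure μ' := ⟨by
    rw [hμ', Measure.smul_apply, Measure.restrict_apply_univ, smul_eq_mul,
      ENNReal.inv_mul_cancel hBpos (measure_ne_top _ _)]⟩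
  have hinv' : ∀ t, S.transitionKernel t ∘ₘ μ' = μ' := fun t => by
    rw [hμ', Measure.comp_smul, hinv]
  -- The noise component evolves on its own, so the noise marginal of `μ'` is invariant and must be
  -- the law of the noise.
  refine ⟨μ', hprob, N.unique _ (Measure.isProbabilityMeasure_map measurable_snd.aemeasurable) ?_,
    hinv', fun t => ?_⟩
  · intro t
    change N.P t ∘ₘ (μ'.map Prod.snd) = _
    conv_rhs => rw [← hinv' t]
    ext D hD
    rw [Measure.bind_apply hD (Kernel.aemeasurable _), Measure.map_apply measurable_snd hD,
      Measure.bind_apply (hD.preimage measurable_snd) (Kernel.aemeasurable _),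
      lintegral_map (Kernel.measurable_coe _ hD) measurable_snd]
    refine lintegral_congr fun z => ?_
    rw [← S.transitionKernel_map_snd, Measure.map_apply measurable_snd hD]
  · have hac : μ' ≪ μ.restrict B := Measure.smul_absolutelyContinuous
    refine hac.ae_le ?_
    filter_upwards [ae_restrict_of_ae (hsz t), ae_restrict_mem hBm] with z hz hzB
    rw [Set.preimage_compl, prob_compl_eq_zero_iff (hA.preimage (measurable_shift t)),
      measure_congr hz]
    exact hzB

end SDS

/-! ### Total variation and separation by continuous functions. -/

section Auxiliary

/-- With the Jordan parts of the difference, `m₁ + negPart = m₂ + posPart`; the excess is at most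
the mass of the positive part. -/
theorem lintegral_le_add_tvNorm {E : Type*} [MeasurableSpace E] (m₁ m₂ : Measure E)
    [IsFiniteMeasure m₁] [IsFiniteMeasure m₂] {g : E → ℝ≥0∞} (hg : ∀ x, g x ≤ 1) :
    ∫⁻ x, g x ∂m₁ ≤ ∫⁻ x, g x ∂m₂ + tvNorm m₁ m₂ := by
  set j := (m₁.toSignedMeasure - m₂.toSignedMeasure).toJordanDecomposition with hj
  have hfp : IsFiniteMeasure j.posPart := j.posPart_finite
  have hfn : IsFiniteMeasure j.negPart := j.negPart_finite
  have h1 : m₁ + j.negPart = m₂ + j.posPart := by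
    apply (Measure.toSignedMeasure_eq_toSignedMeasure_iff).1
    have h2 : j.posPart.toSignedMeasure - j.negPart.toSignedMeasure =
        m₁.toSignedMeasure - m₂.toSignedMeasure :=
      SignedMeasure.toSignedMeasure_toJordanDecomposition _
    rw [Measure.toSignedMeasure_add, Measure.toSignedMeasure_add]
    rw [sub_eq_sub_iff_add_eq_add] at h2
    rw [← h2, add_comm]
  calc ∫⁻ x, g x ∂m₁ ≤ ∫⁻ x, g x ∂(m₁ + j.negPart) :=
        lintegral_mono' (Measure.le_add_right le_rfl) le_rfl
    _ = ∫⁻ x, g x ∂m₂ + ∫⁻ x, g x ∂j.posPart := by rw [h1, lintegral_add_measure]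
    _ ≤ ∫⁻ x, g x ∂m₂ + tvNorm m₁ m₂ := by
        gcongr
        calc ∫⁻ x, g x ∂j.posPart ≤ ∫⁻ _, 1 ∂j.posPart := lintegral_mono hg
          _ = j.posPart Set.univ := lintegral_one
          _ ≤ tvNorm m₁ m₂ := by
            rw [tvNorm, SignedMeasure.totalVariation, Measure.add_apply]
            exact le_self_add

/-- Mutually singular measures are almost separated by a continuous function. -/
theorem exists_continuous_separating {E : Type*} [TopologicalSpace E]
    [TopologicalSpace.MetrizableSpace E] [MeasurableSpace E] [BorelSpace E] (m₁ m₂ : Measure E)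
    [IsProbabilityMeasure m₁] [IsFiniteMeasure m₂] {A : Set E} (hA : MeasurableSet A)
    (h1 : m₁ Aᶜ = 0) (h2 : m₂ A = 0) {c ε : ℝ≥0∞} (hc : c < 1) (hε : 0 < ε) :
    ∃ g : E →ᵇ ℝ≥0, (∀ x, g x ≤ 1) ∧ c < ∫⁻ x, g x ∂m₁ ∧ ∫⁻ x, g x ∂m₂ < ε := by
  let := TopologicalSpace.metrizableSpaceMetric E
  rw [prob_compl_eq_zero_iff hA] at h1
  -- Inner regularity gives a closed `F` inside `A` carrying more than `c` of `m₁` and none of `m₂`.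
  -- Its thickened indicators are continuous, and their `m₂`-integrals tend to `m₂ F = 0`.
  obtain ⟨F, hFA, hF, hcF⟩ := hA.exists_lt_isClosed_of_ne_top (measure_ne_top m₁ A)
    (h1.symm ▸ hc)
  have hF2 : m₂ F = 0 := measure_mono_null hFA h2
  have hδ : ∀ n : ℕ, (0 : ℝ) < 1 / ((n : ℝ) + 1) := fun n => Nat.one_div_pos_of_nat
  have hlim := tendsto_lintegral_thickenedIndicator_of_isClosed m₂ hF hδ
    tendsto_one_div_add_atTop_nhds_zero_nat
  rw [hF2] at hlim
  obtain ⟨n, hn⟩ := (hlim.eventually_lt_const hε).exists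
  refine ⟨thickenedIndicator (hδ n) F, thickenedIndicator_le_one _ _, hcF.trans_le ?_, hn⟩
  exact measure_le_lintegral_thickenedIndicator m₁ hF.measurableSet (hδ n)

theorem metrizableSpace_path {X : Type*} [TopologicalSpace X] [PolishSpace X] (t : ℝ≥0) :
    TopologicalSpace.MetrizableSpace C(Set.Ici t, X) := by
  have : LocallyCompactSpace (Set.Ici t) := isClosed_Ici.locallyCompactSpace
  let := TopologicalSpace.metrizableSpaceMetric X
  exact UniformSpace.metrizableSpace

theorem borelSpace_path {X : Type*} [TopologicalSpace X] [PolishSpace X] [MeasurableSpace X]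
    [BorelSpace X] (t : ℝ≥0) : BorelSpace C(Set.Ici t, X) := by
  have : LocallyCompactSpace (Set.Ici t) := isClosed_Ici.locallyCompactSpace
  infer_instance

end Auxiliary

/-! ### Dependence of future laws on the initial position. -/

namespace SDS

variable {X W : Type*} [TopologicalSpace X] [PolishSpace X] [MeasurableSpace X] [BorelSpace X]
  [TopologicalSpace W] [PolishSpace W] [MeasurableSpace W] [BorelSpace W] {N : StationaryNoise W}

theorem measurable_restrict (t : ℝ≥0) :
    Measurable (ContinuousMap.restrict (Set.Ici t) : C(ℝ≥0, X) → C(Set.Ici t, X)) :=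
  measurable_path_iff.2 fun u => measurable_path_eval (u : ℝ≥0)

theorem futureLaw_eq (S : SDS X N) (t : ℝ≥0) (x : X) {w : W} (hw : w ∈ N.law.support) :
    S.futureLaw t x w = (S.pathKernel (x, w)).map (ContinuousMap.restrict (Set.Ici t)) := by
  rw [futureLaw, S.pathLaw_dirac (z := (x, w)) hw]

theorem isProbabilityMeasure_futureLaw (S : SDS X N) (t : ℝ≥0) (x : X) {w : W}
    (hw : w ∈ N.law.support) : IsProbabilityMeasure (S.futureLaw t x w) := by
  rw [S.futureLaw_eq t x hw]
  exact Measure.isProbabilityMeasure_map (measurable_restrict t).aemeasurable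

/-- The driven path depends continuously on the initial position. -/
theorem continuous_pathMap (S : SDS X N) (w : W) (ω : ℕ → W) :
    Continuous fun x => S.pathMap ((x, w), ω) := by
  by_cases hω : ω ∈ goodNoise N
  · rw [continuous_iff_continuousAt]
    intro x
    rw [ContinuousAt, ContinuousMap.tendsto_compactOpen_iff_forall]
    intro K hK
    -- Up to an integer time `n` bounding `K`, the path is driven by the single noise `ω n`, which
    -- lies in the support, so the continuity axiom of the system applies there.
    obtain ⟨b, hb⟩ := hK.bddAbove
    obtain ⟨n, hn⟩ := exists_nat_ge b
    have hKn : ∀ k : K, (k : ℝ≥0) ≤ n := fun k => (hb k.2).trans hn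
    let ι : C(K, Set.Icc (0 : ℝ≥0) n) := ⟨fun k => ⟨k, zero_le, hKn k⟩, by fun_prop⟩
    let Φ : X × W → C(Set.Icc (0 : ℝ≥0) n, X) := fun p =>
      ⟨fun t => S.Λ t p.1 (N.θ (n - t) p.2), S.continuous_path n p.1 p.2⟩
    have h1 : ContinuousAt Φ (x, ω n) := S.continuousAt_path n x (ω n) (hω n).1
    have h2 : ContinuousAt (fun y => (Φ (y, ω n)).comp ι) x := by
      have h3 : ContinuousAt (fun y : X => (y, ω n)) x := by fun_prop
      have h4 : ContinuousAt (fun y : X => Φ (y, ω n)) x := ContinuousAt.comp (g := Φ) h1 h3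
      exact (ContinuousMap.continuous_precomp ι).continuousAt.comp h4
    have h5 : ∀ y, ContinuousMap.restrict K (S.pathMap ((y, w), ω)) = (Φ (y, ω n)).comp ι := by
      intro y
      ext k
      have : S.pathMap ((y, w), ω) k = S.pathFun y ω k := by simp [pathMap, hω]
      exact this.trans (S.pathFun_eq y hω (hKn k))
    simp only [h5]
    exact h2
  · have : (fun x => S.pathMap ((x, w), ω)) = fun x => ContinuousMap.const _ x := by
      funext x
      simp [pathMap, hω]
    rw [this]
    exact ContinuousMap.continuous_const'

/-- The law of the future depends continuously on the initial position in the weak topology. -/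
theorem continuous_lintegral_futureLaw (S : SDS X N) (t : ℝ≥0) {w : W}
    (hw : w ∈ N.law.support) (g : C(Set.Ici t, X) →ᵇ ℝ≥0) (hg : ∀ f, g f ≤ 1) :
    Continuous fun x => ∫⁻ f, g f ∂(S.futureLaw t x w) := by
  have := borelSpace_path (X := X) t
  have hgm : Measurable fun f => (g f : ℝ≥0∞) := g.continuous.measurable.coe_nnreal_ennreal
  have hpm : ∀ x, Measurable fun ω => S.pathMap ((x, w), ω) := fun x =>
    S.measurable_pathMap.comp (by fun_prop)
  have e : ∀ x, ∫⁻ f, g f ∂(S.futureLaw t x w) =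
      ∫⁻ ω, g (ContinuousMap.restrict (Set.Ici t) (S.pathMap ((x, w), ω))) ∂(noiseChain N w) := by
    intro x
    rw [S.futureLaw_eq t x hw, lintegral_map hgm (measurable_restrict t), pathKernel_apply]
    exact lintegral_map (hgm.comp (measurable_restrict t)) (hpm x)
  simp only [e]
  rw [continuous_iff_continuousAt]
  intro x
  refine tendsto_lintegral_filter_of_dominated_convergence (fun _ => 1)
    (Filter.Eventually.of_forall fun y => hgm.comp ((measurable_restrict t).comp (hpm y)))
    (Filter.Eventually.of_forall fun y => ae_of_all _ fun ω => by exact_mod_cast hg _)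
    (by simp) (ae_of_all _ fun ω => ?_)
  refine (ENNReal.continuous_coe.comp (g.continuous.comp ?_)).continuousAt
  exact (ContinuousMap.continuous_restrict _).comp (S.continuous_pathMap w ω)

/-- If the laws of the future started from points of a dense subset of an open set are closer than
`1 / 2`, then no two laws of the future started from that set are mutually singular. -/
theorem not_singular_of_tvNorm_le (S : SDS X N) (t : ℝ≥0) {w : W} (hw : w ∈ N.law.support)
    {D : Set X} (hD : Dense D) {B : Set X} (hB : IsOpen B)
    (h : ∀ x ∈ D ∩ B, ∀ y ∈ D ∩ B, tvNorm (S.futureLaw t x w) (S.futureLaw t y w) ≤ 2⁻¹)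
    {x y : X} (hx : x ∈ B) (hy : y ∈ B) {A : Set C(Set.Ici t, X)} (hA : MeasurableSet A)
    (h1 : S.futureLaw t x w Aᶜ = 0) : S.futureLaw t y w A ≠ 0 := by
  intro h2
  have := borelSpace_path (X := X) t
  have := metrizableSpace_path (X := X) t
  have := S.isProbabilityMeasure_futureLaw t x hw
  -- The test function has mean above `3/4` at `x` and below `1/4` at `y`. Weak continuity preserves
  -- both bounds at nearby points of `D`, where the total variation bound allows a gap of at most
  -- `1/2`.
  have e34 : (4⁻¹ : ℝ≥0∞) + 2⁻¹ < 1 := by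
    rw [← ENNReal.inv_two_add_inv_two]
    exact ENNReal.add_lt_add_right (by simp) (ENNReal.inv_lt_inv.2 (by norm_num))
  obtain ⟨g, hg, hg1, hg2⟩ := exists_continuous_separating (S.futureLaw t x w)
    (S.futureLaw t y w) hA h1 h2 e34 (ε := 4⁻¹) (by simp)
  have hc := S.continuous_lintegral_futureLaw t hw g hg
  obtain ⟨x₁, ⟨hx₁, hx₁B⟩, hx₁D⟩ := hD.inter_open_nonempty _
    ((isOpen_lt continuous_const hc).inter hB) ⟨x, hg1, hx⟩
  obtain ⟨y₁, ⟨hy₁, hy₁B⟩, hy₁D⟩ := hD.inter_open_nonempty _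
    ((isOpen_lt hc continuous_const).inter hB) ⟨y, hg2, hy⟩
  have h3 := lintegral_le_add_tvNorm (S.futureLaw t x₁ w) (S.futureLaw t y₁ w)
    (g := fun f => g f) (fun f => by exact_mod_cast hg f)
  have h4 : ∫⁻ f, g f ∂(S.futureLaw t x₁ w) ≤ 4⁻¹ + 2⁻¹ :=
    h3.trans (add_le_add hy₁.le (h x₁ ⟨hx₁D, hx₁B⟩ y₁ ⟨hy₁D, hy₁B⟩))
  exact absurd hx₁ (not_lt.2 h4)

/-! ### Singular futures cannot share a noise. -/

/-- If `ℓ x x` were nonzero at a point of the support, continuity would make it nonzero on a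
neighbourhood, which has positive measure. The almost sure vanishing thus holds at every point of
the support. -/
theorem strongFeller_bound_self {ℓ : X → X → W → ℝ≥0}
    (hc : ∀ x y, ∀ w ∈ N.law.support,
      ContinuousAt (fun p : X × X × W => ℓ p.1 p.2.1 p.2.2) (x, y, w))
    (h0 : ∀ x, ∀ᵐ w ∂N.law, ℓ x x w = 0) (x : X) {w : W} (hw : w ∈ N.law.support) :
    ℓ x x w = 0 := by
  by_contra hne
  have h1 : ContinuousAt (fun w' => ℓ x x w') w :=
    ContinuousAt.comp (f := fun w' : W => (x, x, w'))
      (g := fun p : X × X × W => ℓ p.1 p.2.1 p.2.2) (hc x x w hw) (by fun_prop)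
  have h2 : {w' | ℓ x x w' ≠ 0} ∈ 𝓝 w := h1.eventually_ne hne
  exact ((Measure.mem_support_iff_forall w).1 hw _ h2).ne' (h0 x)

theorem continuousAt_Λ (S : SDS X N) (t : ℝ≥0) (x : X) {w : W} (hw : w ∈ N.law.support) :
    ContinuousAt (fun w' => S.Λ t x w') w := by
  have h1 : ContinuousAt (fun f : C(Set.Icc 0 t, X) => f ⟨t, zero_le, le_rfl⟩)
      ((fun p : X × W => (⟨fun u => S.Λ u p.1 (N.θ (t - u) p.2), S.continuous_path t p.1 p.2⟩ :
        C(Set.Icc 0 t, X))) (x, w)) := (continuous_eval_const _).continuousAt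
  have h2 := ContinuousAt.comp h1 (S.continuousAt_path t x w hw)
  have h3 : ContinuousAt (fun w' : W => (x, w')) w := by fun_prop
  have h4 := ContinuousAt.comp (f := fun w' : W => (x, w')) h2 h3
  simpa [Function.comp_def, N.θ_zero] using h4

/-- A property that holds almost everywhere for an invariant probability measure holds after time
`s` for almost every noise and suitable initial positions. -/
theorem ae_exists_ae_of_invariant (S : SDS X N) {μ : Measure (X × W)} [IsProbabilityMeasure μ]
    (hμ : μ.map Prod.snd = N.law) {s : ℝ≥0} (hinv : S.transitionKernel s ∘ₘ μ = μ)
    {p : X × W → Prop} (hp : ∀ᵐ z ∂μ, p z) :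
    ∀ᵐ w ∂N.law, ∃ x, ∀ᵐ w' ∂(N.P s w), p (S.Λ s x w', w') := by
  have hne : Nonempty X := (nonempty_of_isProbabilityMeasure μ).map Prod.fst
  have h1 : ∀ᵐ z ∂μ, z.2 ∈ N.law.support → ∀ᵐ w' ∂(N.P s z.2), p (S.Λ s z.1 w', w') := by
    have h2 : ∀ᵐ z ∂μ, ∀ᵐ z' ∂(S.transitionKernel s z), p z' :=
      Measure.ae_ae_of_ae_comp (by rw [hinv]; exact hp)
    filter_upwards [h2] with z hz hzs
    rw [S.transitionKernel_eq s hzs] at hz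
    exact ae_of_ae_map (S.aemeasurable_Λ s z.1 hzs) hz
  -- The coordinates are swapped because `condKernel` conditions on the first one, here the noise.
  -- The conditional laws are probability measures, so an almost sure property has a witness `x`.
  have h3 : ∀ᵐ z ∂(μ.map Prod.swap), z.1 ∈ N.law.support →
      ∀ᵐ w' ∂(N.P s z.1), p (S.Λ s z.2 w', w') := by
    have hsw : MeasurePreserving (Prod.swap : X × W → W × X) μ (μ.map Prod.swap) :=
      measurable_swap.measurePreserving μ
    have e : μ = (μ.map Prod.swap).map Prod.swap := by
      rw [Measure.map_map measurable_swap measurable_swap]; simp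
    rw [e] at h1
    exact ae_of_ae_map measurable_swap.aemeasurable h1
  have hfst : (μ.map Prod.swap).fst = N.law := by
    rw [← hμ, Measure.fst, Measure.map_map measurable_fst measurable_swap]
    rfl
  have : IsProbabilityMeasure (μ.map (Prod.swap : X × W → W × X)) :=
    Measure.isProbabilityMeasure_map measurable_swap.aemeasurable
  rw [← (μ.map Prod.swap).disintegrate (μ.map Prod.swap).condKernel, hfst] at h3
  filter_upwards [Measure.ae_ae_of_ae_compProd h3, Measure.support_mem_ae (μ := N.law)]
    with w hw hws
  obtain ⟨x, hx⟩ := hw.exists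
  exact ⟨x, hx hws⟩

/-- Two points whose futures stay on opposite sides of a set cannot be driven by the same noise. -/
theorem not_separated (S : SDS X N) (hS : S.IsQuasiMarkovian) {s t : ℝ≥0} (hs : 0 < s)
    (ht : 0 < t) {ℓ : X → X → W → ℝ≥0}
    (hc : ∀ x y, ∀ w ∈ N.law.support,
      ContinuousAt (fun p : X × X × W => ℓ p.1 p.2.1 p.2.2) (x, y, w))
    (h0 : ∀ x, ∀ᵐ w ∂N.law, ℓ x x w = 0) {D : Set X} (hD : Dense D) {w : W}
    (hw : w ∈ N.law.support)
    (htv : ∀ᵐ w' ∂(N.P s w), ∀ x ∈ D, ∀ y ∈ D,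
      tvNorm (S.futureLaw t x w') (S.futureLaw t y w') ≤ ℓ x y w')
    (hirr : ∀ x : X, ∀ U : Set X, IsOpen U → U.Nonempty → 0 < S.Q s (x, w) (U ×ˢ Set.univ))
    {A : Set C(Set.Ici t, X)} (hA : MeasurableSet A) {x y : X}
    (hx : ∀ᵐ w' ∂(N.P s w), S.futureLaw t (S.Λ s x w') w' Aᶜ = 0)
    (hy : ∀ᵐ w' ∂(N.P s w), S.futureLaw t (S.Λ s y w') w' A = 0) : False := by
  have hsupp := ae_mem_support N s hw
  obtain ⟨w₁, hw₁, hw₁P⟩ := (hsupp.and (Measure.support_mem_ae (μ := N.P s w))).exists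
  set y₁ := S.Λ s y w₁ with hy₁
  have hℓ : ∀ᶠ p : X × X × W in 𝓝 (y₁, y₁, w₁), ℓ p.1 p.2.1 p.2.2 < 2⁻¹ := by
    refine (hc y₁ y₁ w₁ hw₁).eventually_lt_const ?_
    simp [strongFeller_bound_self hc h0 y₁ hw₁]
  obtain ⟨B, V, hBo, hVo, hyB, hwV, hBV⟩ : ∃ (B : Set X) (V : Set W), IsOpen B ∧ IsOpen V ∧
      y₁ ∈ B ∧ w₁ ∈ V ∧ ∀ a ∈ B, ∀ b ∈ B, ∀ v ∈ V, ℓ a b v < 2⁻¹ := by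
    rw [nhds_prod_eq, nhds_prod_eq, Filter.eventually_prod_iff] at hℓ
    obtain ⟨pa, hpa, pq, hpq, hab⟩ := hℓ
    obtain ⟨pb, hpb, pv, hpv, hbv⟩ := Filter.eventually_prod_iff.1 hpq
    obtain ⟨B, hB, hBo, hyB⟩ := eventually_nhds_iff.1 (hpa.and hpb)
    obtain ⟨V, hV, hVo, hwV⟩ := eventually_nhds_iff.1 hpv
    exact ⟨B, V, hBo, hVo, hyB, hwV, fun a ha b hb v hv =>
      hab (hB a ha).1 (hbv (hB b hb).2 (hV v hv))⟩
  obtain ⟨V', hV', hV'o, hwV'⟩ := eventually_nhds_iff.1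
    (((S.continuousAt_Λ s y hw₁).eventually (hBo.mem_nhds hyB)).and (hVo.mem_nhds hwV))
  -- Irreducibility brings `x` into the ball around the point reached from `y`, but possibly under
  -- noises far from `w₁`.
  have hpos : ∃ᵐ w' ∂(N.P s w), S.Λ s x w' ∈ B := by
    have h1 := hirr x B hBo ⟨y₁, hyB⟩
    rw [Q, Measure.map_apply_of_aemeasurable (S.aemeasurable_Λ s x hw)
      (hBo.measurableSet.prod MeasurableSet.univ)] at h1
    refine frequently_ae_iff.2 ?_
    simpa [Set.preimage, Set.mem_prod] using h1.ne'
  obtain ⟨w₂, hw₂B, hw₂, hw₂P⟩ :=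
    (hpos.and_eventually (hsupp.and (Measure.support_mem_ae (μ := N.P s w)))).exists
  obtain ⟨U, hU, hUo, hwU⟩ := eventually_nhds_iff.1
    ((S.continuousAt_Λ s x hw₂).eventually (hBo.mem_nhds hw₂B))
  have hPV : 0 < N.P s w V' := (Measure.mem_support_iff_forall w₁).1 hw₁P _ (hV'o.mem_nhds hwV')
  have hPU : 0 < N.P s w U := (Measure.mem_support_iff_forall w₂).1 hw₂P _ (hUo.mem_nhds hwU)
  obtain ⟨K, hK, hKpos⟩ := hS U V' hUo hV'o s t hs ht
  have hKw := hKpos ⟨w, hw⟩ (lt_min hPU hPV)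
  obtain ⟨hK1, hK2⟩ := hK ⟨w, hw⟩
  have hfst : ∀ {p : W → Prop}, (∀ᵐ v ∂((N.P s w).restrict U), p v) →
      ∀ᵐ q ∂(K ⟨w, hw⟩), p q.1 := fun h =>
    ae_of_ae_map measurable_fst.aemeasurable (Measure.absolutelyContinuous_of_le hK1 |>.ae_le h)
  have hsnd : ∀ {p : W → Prop}, (∀ᵐ v ∂((N.P s w).restrict V'), p v) →
      ∀ᵐ q ∂(K ⟨w, hw⟩), p q.2 := fun h =>
    ae_of_ae_map measurable_snd.aemeasurable (Measure.absolutelyContinuous_of_le hK2 |>.ae_le h)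
  -- `equivalentNoises` need not be measurable, but a set of positive outer measure still meets
  -- every almost sure event.
  have hfreq : ∃ᵐ q ∂(K ⟨w, hw⟩), q ∈ S.equivalentNoises t := frequently_ae_iff.2 hKw.ne'
  obtain ⟨⟨v₁, v₂⟩, hq, ⟨h1, h2⟩, ⟨h3, h4⟩, h5, h6⟩ := (hfreq.and_eventually
    ((hfst ((ae_restrict_mem hUo.measurableSet).and (ae_restrict_of_ae hx))).and
    ((hsnd ((ae_restrict_mem hV'o.measurableSet).and (ae_restrict_of_ae hy))).and
    (hsnd ((ae_restrict_of_ae hsupp).and (ae_restrict_of_ae htv)))))).exists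
  -- Equivalence of `v₁` and `v₂` transfers the future from `Λ_s(x, v₁)` to the noise `v₂`: it still
  -- gives `A` full measure, while the future from `Λ_s(y, v₂)` under `v₂` gives it none.
  refine S.not_singular_of_tvNorm_le t h5 hD hBo (fun a ha b hb => ?_) (hU v₁ h1) (hV' v₂ h3).1 hA
    ((hq _).2 h2) h4
  refine (h6 a ha.1 b hb.1).trans ?_
  have := (hBV a ha.2 b hb.2 v₂ (hV' v₂ h3).2).le
  rw [← ENNReal.coe_two, ← ENNReal.coe_inv two_ne_zero]
  exact_mod_cast this

end SDS

/-! ### Uniqueness up to equivalence. -/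

theorem mainTheorem7 {X W : Type*}
    [TopologicalSpace X] [PolishSpace X] [MeasurableSpace X] [BorelSpace X]
    [TopologicalSpace W] [PolishSpace W] [MeasurableSpace W] [BorelSpace W]
    (N : StationaryNoise W) (S : SDS X N) (hS : S.IsQuasiMarkovian)
    (h : ∃ s t : ℝ≥0, 0 < s ∧ 0 < t ∧ S.IsStrongFellerAt t ∧ S.IsTopologicallyIrreducibleAt s)
    (μ ν : Measure (X × W)) (hμ : S.IsInvariantMeasure μ) (hν : S.IsInvariantMeasure ν) :
    S.Equivalent μ ν := by
  obtain ⟨s, t, hs, ht, ⟨ℓ, hc, h0, htv⟩, hirr⟩ := h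
  have := hμ.1.1
  have := hν.1.1
  rw [SDS.Equivalent, S.pathLaw_eq μ hμ.1.ae_mem_support, S.pathLaw_eq ν hν.1.ae_mem_support]
  by_contra hne
  obtain ⟨A, hA, hAμ, hAν, hinv⟩ := exists_separating_set hne
  have hAs : ∀ u, SDS.shift u ⁻¹' A =ᵐ[S.pathKernel ∘ₘ μ + S.pathKernel ∘ₘ ν] A := fun u =>
    hinv _ (SDS.measurable_shift u) (hμ.map_shift u) (hν.map_shift u)
  obtain ⟨μ', hμ'p, hμ'l, hμ'i, hμ'A⟩ := S.exists_invariant_ae_one hμ hA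
    (fun u => (Measure.absolutelyContinuous_of_le (Measure.le_add_right le_rfl)).ae_le (hAs u)) hAμ
  obtain ⟨ν', hν'p, hν'l, hν'i, hν'A⟩ := S.exists_invariant_ae_one hν hA.compl
    (fun u => (Measure.absolutelyContinuous_of_le (Measure.le_add_left le_rfl)).ae_le
      (hAs u).compl) hAν
  -- Reindexing paths on `[t, ∞)` by `[0, ∞)`: restriction followed by `τ` is `shift t`, so shifted
  -- events become events of `futureLaw`.
  let τ : C(Set.Ici t, X) → C(ℝ≥0, X) := fun f =>
    f.comp ⟨fun u => ⟨t + u, Set.mem_Ici.2 le_self_add⟩,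
      Continuous.subtype_mk (by fun_prop) _⟩
  have hτ : Measurable τ := SDS.measurable_path_iff.2 fun u => SDS.measurable_path_eval _
  have hfut : ∀ {E : Set C(ℝ≥0, X)}, MeasurableSet E → ∀ z : X × W, z.2 ∈ N.law.support →
      S.pathKernel z (SDS.shift t ⁻¹' E) = 0 → S.futureLaw t z.1 z.2 (τ ⁻¹' E) = 0 := by
    intro E hE z hz h
    rw [S.futureLaw_eq t z.1 hz, Measure.map_apply (SDS.measurable_restrict t) (hτ hE)]
    exact h
  have hsupp : ∀ {m : Measure (X × W)}, IsProbabilityMeasure m → m.map Prod.snd = N.law →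
      ∀ᵐ z ∂m, z.2 ∈ N.law.support := fun hp hl =>
    SDS.IsGeneralisedInitialCondition.ae_mem_support (S := S) ⟨hp, hl⟩
  have h1 := S.ae_exists_ae_of_invariant hμ'l (hμ'i s)
    (p := fun z => S.futureLaw t z.1 z.2 (τ ⁻¹' Aᶜ) = 0) (by
      filter_upwards [hμ'A t, hsupp hμ'p hμ'l] with z hz hzs using hfut hA.compl z hzs hz)
  have h2 := S.ae_exists_ae_of_invariant hν'l (hν'i s)
    (p := fun z => S.futureLaw t z.1 z.2 (τ ⁻¹' A) = 0) (by
      filter_upwards [hν'A t, hsupp hν'p hν'l] with z hz hzs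
      exact hfut hA z hzs (by rwa [compl_compl] at hz))
  -- The null set in the strong Feller bound depends on the pair of points; a countable dense set
  -- gives a common one, which invariance of `N.law` carries to time `s`.
  obtain ⟨D, hDc, hD⟩ := TopologicalSpace.exists_countable_dense X
  have h3 : ∀ᵐ w ∂N.law, ∀ᵐ w' ∂(N.P s w), ∀ x ∈ D, ∀ y ∈ D,
      tvNorm (S.futureLaw t x w') (S.futureLaw t y w') ≤ ℓ x y w' := by
    refine Measure.ae_ae_of_ae_comp ?_
    have e : N.P s ∘ₘ N.law = N.law := N.invariant s
    rw [e]
    exact (ae_ball_iff hDc).2 fun x _ => (ae_ball_iff hDc).2 fun y _ => htv x y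
  -- One `w` serves both measures because they share the noise marginal. Since `x` depends on `w`,
  -- the null set in the irreducibility assumption must be uniform in the position.
  obtain ⟨w, hw, ⟨x, hx⟩, ⟨y, hy⟩, hw3, hwi⟩ :=
    (Filter.Eventually.and (Measure.support_mem_ae (μ := N.law))
      (h1.and (h2.and (h3.and hirr)))).exists
  exact S.not_separated hS hs ht hc h0 hD hw hw3 hwi (hτ hA) hx hy
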